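/- Let $K$ be a field, $R=K[X_1,\dots,X_n]$ with its standard grading, and for $1\le k\le n$ let $M(n,k)$ be the $k$-th syzygy module of the residue class field $K=R/(X_1,\dots,X_n)$, that is, the image of the differential $\bigwedge^kR^n\to\bigwedge^{k-1}R^n$ of the Koszul complex of $X_1,\dots,X_n$, with the grading in which $e_{i_1}\wedge\dots\wedge e_{i_j}$ has degree $j$. A Hilbert decomposition of a finitely generated graded $R$-module $M$ is a finite family $(S_i,s_i)_{i\in I}$, where $s_i\in\mathbb Z$ and each $S_i\subseteq R$ is a graded retract of $R$ (a $K$-subalgebra with a graded $K$-algebra epimorphism $R\to S_i$ that is the identity on $S_i$), such that $M\cong\bigoplus_{i\in I}S_i(-s_i)$ as graded $K$-vector spaces. Each $S_i$ is a polynomial ring in $d_i$ linear forms; the depth of the decomposition is $\min_i d_i$, and $\operatorname{Hdepth}_1M$ is the maximal depth of a Hilbert decomposition of $M$ (with $\operatorname{Hdepth}_10=\infty$). **Theorem.** Let $\beta$ be a real number with $0<\beta\le 1/2$, and let $k=k(n)$ be a sequence of nonnegative integers with $k=\beta n+o(n)$ as $n\to\infty$. For real $\gamma$ with $(1-2\beta-2\gamma)^2-8\beta\gamma\ge0$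 put $$\alpha=\alpha(\beta,\gamma)=\tfrac14\Bigl(1-2\beta-2\gamma+\sqrt{(1-2\beta-2\gamma)^2-8\beta\gamma}\Bigr).$$ Then, with the convention $0^0=1$, the equation $$\frac{(\alpha+\gamma)^{\alpha+\gamma}\,(\alpha+\beta)^{\alpha+\beta}\,(1-\alpha-\beta-\gamma)^{1-\alpha-\beta-\gamma}}{\alpha^{\alpha}\,\beta^{\beta}\,\gamma^{\gamma}\,(1-\beta)^{1-\beta}\,(1-\gamma)^{1-\gamma}}=1$$ has a smallest nonnegative solution $\gamma$ (among the $\gamma$ for which the square root is real), and for this $\gamma$ $$\operatorname{Hdepth}_1M(n,k)=(1-\gamma)\,n+o(n)\qquad\text{as }n\to\infty,$$ where $\operatorname{Hdepth}_1M(n,k)$ is finite for all sufficiently large $n$. -/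

import Mathlib

open Filter Asymptotics MvPolynomial

noncomputable section

namespace HilbertDepth

/-- The degree `d` component, for `d : ℤ`, of the polynomial ring `R = K[X₁, …, Xₙ]` in its
standard grading (zero in negative degrees). -/
def polyPiece (K : Type*) [Field K] (n : ℕ) (d : ℤ) : Submodule K (MvPolynomial (Fin n) K) :=
  if 0 ≤ d then homogeneousSubmodule (Fin n) K d.toNat else ⊥

/-- A graded retract of `R = K[X₁, …, Xₙ]` (standard grading): a `K`-subalgebra `S` of `R` that
admits a graded `K`-algebra epimorphism `π : R → S` with `π|S = id`. -/
structure GradedRetract (K : Type*) [Field K] (n : ℕ) where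
  /-- The underlying subalgebra `S`. -/
  alg : Subalgebra K (MvPolynomial (Fin n) K)
  exists_retraction : ∃ π : MvPolynomial (Fin n) K →ₐ[K] alg,
    (∀ (p : MvPolynomial (Fin n) K) (d : ℕ), p.IsHomogeneous d →
      (π p : MvPolynomial (Fin n) K).IsHomogeneous d) ∧
    ∀ x : alg, π (x : MvPolynomial (Fin n) K) = x

/-- The degree `d` component of a graded retract. -/
def GradedRetract.piece {K : Type*} [Field K] {n : ℕ} (S : GradedRetract K n) (d : ℤ) :
    Submodule K (MvPolynomial (Fin n) K) :=
  Subalgebra.toSubmodule S.alg ⊓ polyPiece K n d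

/-- A graded retract is a polynomial ring over `K` in linear forms. Its number of variables,
which is its depth as a module, is the dimension of its component of degree `1`. -/
def GradedRetract.numVars {K : Type*} [Field K] {n : ℕ} (S : GradedRetract K n) : ℕ :=
  Module.finrank K (S.piece 1)

/-- A Hilbert decomposition, over `R = K[X₁, …, Xₙ]` with the standard grading, of a graded vector
space with components `𝓜 d`, `d : ℤ`: a finite family of graded retracts `Sᵢ` of `R` and shifts
`sᵢ : ℤ` such that `⨁ᵢ Sᵢ(-sᵢ)` is isomorphic to it as a graded `K`-vector space. -/
structure HilbertDecomposition {K : Type*} [Field K] (n : ℕ) {V : Type*} [AddCommGroup V]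
    [Module K V] (𝓜 : ℤ → Submodule K V) where
  /-- The number of summands. -/
  size : ℕ
  /-- The graded retracts `Sᵢ`. -/
  retract : Fin size → GradedRetract K n
  /-- The shifts `sᵢ`. -/
  shift : Fin size → ℤ
  iso : ∀ d : ℤ, Nonempty (𝓜 d ≃ₗ[K] ((i : Fin size) → (retract i).piece (d - shift i)))

/-- The depth of `⨁ᵢ Sᵢ(-sᵢ)`: the least number of variables of a summand
(`⊤` if there are no summands, i.e. for the zero module). -/
def HilbertDecomposition.depth {K : Type*} [Field K] {n : ℕ} {V : Type*} [AddCommGroup V]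
    [Module K V] {𝓜 : ℤ → Submodule K V} (H : HilbertDecomposition n 𝓜) : ℕ∞ :=
  ⨅ i : Fin H.size, ((H.retract i).numVars : ℕ∞)

/-- The (standard graded) Hilbert depth: the maximal depth of a Hilbert decomposition. -/
def hilbertDepth {K : Type*} [Field K] (n : ℕ) {V : Type*} [AddCommGroup V] [Module K V]
    (𝓜 : ℤ → Submodule K V) : ℕ∞ :=
  ⨆ H : HilbertDecomposition n 𝓜, H.depth

/-- The total module `⨁ₖ ⋀ᵏ Rⁿ` of the Koszul complex of `X₁, …, Xₙ` over `R = K[X₁, …, Xₙ]`.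
It is free on the basis vectors `e_S = e_{i₁} ∧ ⋯ ∧ e_{iₖ}`, where `S = {i₁ < ⋯ < iₖ}` runs through
the subsets of the index set; an element is given by its coefficients. -/
abbrev Koszul (K : Type*) [Field K] (n : ℕ) : Type _ :=
  Finset (Fin n) → MvPolynomial (Fin n) K

/-- The summand `⋀ᵏ Rⁿ` of the total Koszul module. -/
def koszulTerm (K : Type*) [Field K] (n k : ℕ) :
    Submodule (MvPolynomial (Fin n) K) (Koszul K n) where
  carrier := {f | ∀ S : Finset (Fin n), S.card ≠ k → f S = 0}
  add_mem' := fun hf hg S hS => by simp [hf S hS, hg S hS]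
  zero_mem' := fun _ _ => rfl
  smul_mem' := fun c f hf S hS => by simp [hf S hS]

/-- The Koszul differential,
`∂ e_S = ∑_{i ∈ S} (-1) ^ #{j ∈ S | j < i} X_i e_{S \ {i}}`, written on coefficients:
the coefficient of `e_T` in `∂ f` collects the contributions of the sets `S = T ∪ {i}`, `i ∉ T`. -/
def koszulD (K : Type*) [Field K] (n : ℕ) :
    Koszul K n →ₗ[MvPolynomial (Fin n) K] Koszul K n where
  toFun f T := ∑ i ∈ Tᶜ, (-1) ^ (T.filter (· < i)).card * X i * f (insert i T)
  map_add' f g := by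
    funext T
    simp [mul_add, Finset.sum_add_distrib]
  map_smul' c f := by
    funext T
    simp only [Pi.smul_apply, smul_eq_mul, RingHom.id_apply, Finset.mul_sum]
    exact Finset.sum_congr rfl fun i _ => by ring

/-- The degree `d` component of the total Koszul module in the standard grading, in which `e_S`
has degree `|S|`. -/
def koszulPiece (K : Type*) [Field K] (n : ℕ) (d : ℤ) : Submodule K (Koszul K n) :=
  Submodule.pi Set.univ fun S : Finset (Fin n) => polyPiece K n (d - S.card)

/-- The `k`-th syzygy module `M(n, k)`, `k ≥ 1`, of the residue class field
`K = R / (X₁, …, Xₙ)`: the image of `∂ : ⋀ᵏ Rⁿ → ⋀ᵏ⁻¹ Rⁿ` in the Koszul complex, the minimal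
graded free resolution of `K`. -/
def syzygy (K : Type*) [Field K] (n k : ℕ) :
    Submodule (MvPolynomial (Fin n) K) (Koszul K n) :=
  (koszulTerm K n k).map (koszulD K n)

/-- The standard grading of `M(n, k)`. -/
def syzygyPiece (K : Type*) [Field K] (n k : ℕ) (d : ℤ) : Submodule K (Koszul K n) :=
  (syzygy K n k).restrictScalars K ⊓ koszulPiece K n d

/-- `Hdepth₁ M(n, k)`, the Hilbert depth of `M(n, k)` in the standard grading. -/
def syzygyHdepth (K : Type*) [Field K] (n k : ℕ) : ℕ∞ :=
  hilbertDepth n (syzygyPiece K n k)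

/-- The function `f(α, β, γ)`. -/
def quotBase (α β γ : ℝ) : ℝ :=
  ((α + γ) ^ (α + γ) * (α + β) ^ (α + β) * (1 - α - β - γ) ^ (1 - α - β - γ)) /
    (α ^ α * β ^ β * γ ^ γ * (1 - β) ^ (1 - β) * (1 - γ) ^ (1 - γ))

/-- The expression under the square root in the formula for the critical point. -/
def critDisc (β γ : ℝ) : ℝ := (1 - 2 * β - 2 * γ) ^ 2 - 8 * β * γ

/-- The critical point `α`, meaningful for `0 ≤ critDisc β γ`. -/
def critPoint (β γ : ℝ) : ℝ := (1 / 4) * (1 - 2 * β - 2 * γ + √(critDisc β γ))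

end HilbertDepth

end

/-! The proof turns Hilbert depth into a positivity question about a power series and then decides
the signs of its coefficients to exponential accuracy.

Exactness of the Koszul complex gives the Hilbert series of M(n, k), up to the shift by T^k, as P(T)
/ (1 - T)^n with P(T) = ∑ (-1)^m C(n, k + m) T^m (`finrank_syzygyPiece`). A graded retract has the
Hilbert series of a polynomial ring. Hence, for 2 ≤ k ≤ n and r ≤ n, a decomposition of depth at
least r exists exactly when P(T) / (1 - T)^(n - r) has nonnegative coefficients
(`truncCoeff_nonneg_of_decomposition`, `exists_decomposition`).

For g = n - r these coefficients satisfy a first-order recurrence (`truncCoeff_recurrence`) whose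
homogeneous solution is the alternating binomial (-1)^m C(n - g, k + m). What is left after
subtracting it, `posCoeff`, is nonnegative and, by `posCoeff_upper` and `posCoeff_lower`, equals
C(n, k) C(g + m, m + 1) up to polynomial factors at index m + 1. So a negative coefficient can only
come from an odd index at which C(n - g, k + m + 1) wins against that product.

With index αn, k = βn, g = γn, Stirling bounds show that the logarithm of the quotient of the two
sides is n `logQuot α β γ` + O(log n) (`log_choose_quotient_bounds`). The rate `logQuot` increases
strictly in γ. As a function of α it starts at a nonnegative value and can only dip at the larger
root of a quadratic, which is `critPoint`. Hence at the least zero γ₀ of γ ↦ `logQuot (critPoint β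
γ) β γ` the rate is nonnegative for all α and zero for one α (`exists_least_solution`). For γ > γ₀
it is uniformly positive, which gives the lower bound on the depth (`eventually_le_syzygyHdepth`);
for γ < γ₀ it is negative at that α, which gives the upper bound (`eventually_syzygyHdepth_le`). -/

noncomputable section

namespace HilbertDepth

/-! ### Signs of the coefficients: recurrence and two-sided bounds. -/

/-- The coefficients of `∑ₘ (-1)ᵐ C(n, k + m) Tᵐ / (1 - T)ᵍ`. -/
def truncCoeff (n k : ℕ) : ℕ → ℕ → ℤ
  | 0, m => (-1) ^ m * (n.choose (k + m) : ℤ)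
  | g + 1, m => ∑ i ∈ Finset.range (m + 1), truncCoeff n k g i

theorem truncCoeff_zero_right (n k g : ℕ) : truncCoeff n k g 0 = n.choose k := by
  induction g with
  | zero => simp [truncCoeff]
  | succ g ih => simp [truncCoeff, ih]

theorem truncCoeff_succ_succ (n k g m : ℕ) :
    truncCoeff n k (g + 1) (m + 1) = truncCoeff n k (g + 1) m + truncCoeff n k g (m + 1) := by
  simp [truncCoeff, Finset.sum_range_succ _ (m + 1)]

theorem cast_choose_succ_mul (n k : ℕ) :
    ((k : ℤ) + 1) * (n.choose (k + 1) : ℤ) = ((n : ℤ) - k) * n.choose k := by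
  rcases le_or_gt k n with h | h
  · have := Nat.choose_succ_right_eq n k
    zify [h] at this
    linarith
  · simp [Nat.choose_eq_zero_of_lt h, Nat.choose_eq_zero_of_lt (h.trans (Nat.lt_succ_self k))]

/-- The recurrence coming from the differential equation
`(1 - T) F' + r F = k C(n, k) Tᵏ⁻¹ (1 - T)⁻ᵍ`, `r = n - g`. -/
theorem truncCoeff_recurrence (n k g m : ℕ) :
    ((k : ℤ) + m + 1) * truncCoeff n k g (m + 1) + ((n : ℤ) - g - k - m) * truncCoeff n k g m =
      k * n.choose k * (g + m).choose (m + 1) := by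
  induction g generalizing m with
  | zero =>
    have := cast_choose_succ_mul n (k + m)
    push_cast at this
    simp only [truncCoeff, ← add_assoc, zero_add, Nat.choose_succ_self, pow_succ]
    push_cast
    linear_combination (-(-1) ^ m) * this
  | succ g ih =>
    induction m with
    | zero =>
      have h := ih 0
      simp only [truncCoeff_succ_succ, truncCoeff_zero_right, Nat.choose_one_right, zero_add,
        add_zero] at h ⊢
      push_cast at h ⊢
      linear_combination h
    | succ m ihm =>
      -- The identity at (g + 1, m + 1) is the sum of those at (g, m + 1) and (g + 1, m), by
      -- Pascal's rule on the right and partial summation on the left.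
      have h := ih (m + 1)
      have e : (g + 1 + (m + 1)).choose (m + 1 + 1) =
          (g + (m + 1)).choose (m + 1) + (g + (m + 1)).choose (m + 1 + 1) := by
        rw [show g + 1 + (m + 1) = g + (m + 1) + 1 by ring, Nat.choose_succ_succ']
      rw [show g + 1 + m = g + (m + 1) by ring] at ihm
      rw [e, truncCoeff_succ_succ n k g (m + 1)]
      have h' := truncCoeff_succ_succ n k g m
      push_cast at h ihm ⊢
      linear_combination h + ihm
        + ((n : ℤ) - g - k - (m + 1)) * h'

/-- The coefficients of `truncCoeff` without the alternating contribution of `(1 - T)ⁿ⁻ᵍ`. -/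
def posCoeff (n k g m : ℕ) : ℤ :=
  truncCoeff n k g m - (-1) ^ m * ((n - g).choose (k + m) : ℤ)

theorem posCoeff_succ_succ {n g : ℕ} (h : g + 1 ≤ n) (k m : ℕ) :
    posCoeff n k (g + 1) (m + 1) = posCoeff n k (g + 1) m + posCoeff n k g (m + 1) := by
  have : (n - g).choose (k + (m + 1)) =
      (n - (g + 1)).choose (k + m) + (n - (g + 1)).choose (k + (m + 1)) := by
    rw [show n - g = n - (g + 1) + 1 by omega, ← add_assoc, Nat.choose_succ_succ']
  simp only [posCoeff, truncCoeff_succ_succ, this, pow_succ]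
  push_cast
  ring

/-- The Pascal-type rule `posCoeff_succ_succ` propagates nonnegativity from the boundary: the values
are 0 at g = 0 and C(n, k) - C(n - g, k) at m = 0. -/
theorem posCoeff_nonneg {n g : ℕ} (h : g ≤ n) (k m : ℕ) : 0 ≤ posCoeff n k g m := by
  induction g generalizing m with
  | zero => simp [posCoeff, truncCoeff]
  | succ g ih =>
    induction m with
    | zero =>
      have : (n - (g + 1)).choose k ≤ n.choose k := Nat.choose_le_choose k (by omega)
      simp only [posCoeff, truncCoeff_zero_right, pow_zero, one_mul, add_zero]
      exact_mod_cast sub_nonneg.2 (Int.ofNat_le.2 this)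
    | succ m ihm =>
      rw [posCoeff_succ_succ h]
      exact add_nonneg ihm (ih (by omega) _)

/-- The subtracted alternating binomial solves the homogeneous recurrence, so the right-hand side is
the same as for `truncCoeff`. -/
theorem posCoeff_recurrence {n g : ℕ} (h : g ≤ n) (k m : ℕ) :
    ((k : ℤ) + m + 1) * posCoeff n k g (m + 1) + ((n : ℤ) - g - k - m) * posCoeff n k g m =
      k * n.choose k * (g + m).choose (m + 1) := by
  have h1 := truncCoeff_recurrence n k g m
  have h2 := cast_choose_succ_mul (n - g) (k + m)
  simp only [posCoeff, pow_succ, ← add_assoc]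
  push_cast [h] at h2 ⊢
  linear_combination h1 + (-1) ^ m * h2

theorem posCoeff_upper {n k g m : ℕ} (h : k + m + g ≤ n) :
    ((k : ℤ) + m + 1) * posCoeff n k g (m + 1) ≤ k * n.choose k * (g + m).choose (m + 1) := by
  rw [← posCoeff_recurrence (by omega : g ≤ n)]
  have : 0 ≤ ((n : ℤ) - g - k - m) * posCoeff n k g m :=
    mul_nonneg (by omega) (posCoeff_nonneg (by omega) _ _)
  linarith

/-- For g ≥ 1 the sequence is nondecreasing in m, since its differences are values for g - 1.
Replacing the m-th term of the recurrence by the next one adds the two weights up to n - g + 1. -/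
theorem posCoeff_lower {n k g m : ℕ} (hg : 1 ≤ g) (h : k + m + g ≤ n) :
    (k : ℤ) * n.choose k * (g + m).choose (m + 1) ≤ ((n : ℤ) - g + 1) * posCoeff n k g (m + 1) := by
  rw [← posCoeff_recurrence (by omega : g ≤ n)]
  obtain ⟨g, rfl⟩ : ∃ g', g = g' + 1 := ⟨g - 1, by omega⟩
  have h1 := posCoeff_succ_succ (by omega : g + 1 ≤ n) k m
  have h2 := posCoeff_nonneg (by omega : g ≤ n) k (m + 1)
  have : ((n : ℤ) - (g + 1 : ℕ) - k - m) * posCoeff n k (g + 1) m ≤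
      ((n : ℤ) - (g + 1 : ℕ) - k - m) * posCoeff n k (g + 1) (m + 1) :=
    mul_le_mul_of_nonneg_left (by linarith) (by omega)
  linarith

theorem truncCoeff_nonneg_of_lt {n k g m : ℕ} (hg : g ≤ n) (h : n - g < k + m) :
    0 ≤ truncCoeff n k g m := by
  have := posCoeff_nonneg hg k m
  simpa [posCoeff, Nat.choose_eq_zero_of_lt h] using this

/-- A sufficient condition for the nonnegativity of all coefficients. -/
theorem truncCoeff_nonneg {n k g : ℕ} (hg : 1 ≤ g) (hgn : g ≤ n)
    (h : ∀ m, k + m + 1 + g ≤ n → (n - g + 1) * (n - g).choose (k + m + 1) ≤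
      k * n.choose k * (g + m).choose (m + 1)) (m : ℕ) : 0 ≤ truncCoeff n k g m := by
  rcases lt_or_ge (n - g) (k + m) with h1 | h1
  · exact truncCoeff_nonneg_of_lt hgn h1
  have hp := posCoeff_nonneg hgn k m
  cases m with
  | zero => rw [truncCoeff_zero_right]; positivity
  | succ m =>
    have h2 := posCoeff_lower hg (by omega : k + m + g ≤ n)
    have h3 := h m (by omega)
    zify [hgn] at h3
    have h4 : (((n - g).choose (k + (m + 1)) : ℕ) : ℤ) ≤ posCoeff n k g (m + 1) :=
      le_of_mul_le_mul_left (h3.trans h2) (by omega)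
    have h5 : -(((n - g).choose (k + (m + 1)) : ℕ) : ℤ) ≤
        (-1) ^ (m + 1) * ((n - g).choose (k + (m + 1)) : ℤ) := by
      rcases neg_one_pow_eq_or ℤ (m + 1) with e | e <;> rw [e] <;> simp
    have : truncCoeff n k g (m + 1) = posCoeff n k g (m + 1) +
      (-1) ^ (m + 1) * ((n - g).choose (k + (m + 1)) : ℤ) := by simp [posCoeff]
    linarith

/-- A sufficient condition for the negativity of a coefficient. -/
theorem truncCoeff_neg {n k g m : ℕ} (hm : Even m) (hn : k + m + 1 + g ≤ n)
    (h : k * n.choose k * (g + m).choose (m + 1) < (k + m + 1) * (n - g).choose (k + m + 1)) :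
    truncCoeff n k g (m + 1) < 0 := by
  have h1 := posCoeff_upper (by omega : k + m + g ≤ n)
  zify at h
  have h2 : posCoeff n k g (m + 1) < ((n - g).choose (k + (m + 1)) : ℤ) :=
    lt_of_mul_lt_mul_left (h1.trans_lt h) (by positivity)
  have : truncCoeff n k g (m + 1) = posCoeff n k g (m + 1) +
    (-1) ^ (m + 1) * ((n - g).choose (k + (m + 1)) : ℤ) := by simp [posCoeff]
  -- The index m + 1 is odd, so the binomial enters with a minus sign.
  rw [this, pow_succ, hm.neg_one_pow]
  linarith

/-! ### Power series identities. -/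

/-- The geometric series `1 / (1 - T)`. -/
def geom : PowerSeries ℤ := PowerSeries.mk 1

theorem geom_mul : geom * (1 - PowerSeries.X) = 1 := PowerSeries.mk_one_mul_one_sub_eq_one ℤ

theorem coeff_mul_geom (A : PowerSeries ℤ) (m : ℕ) :
    PowerSeries.coeff m (A * geom) = ∑ i ∈ Finset.range (m + 1), PowerSeries.coeff i A := by
  rw [PowerSeries.coeff_mul, Finset.Nat.sum_antidiagonal_eq_sum_range_succ_mk]
  simp [geom]

theorem coeff_geom_pow (d m : ℕ) :
    PowerSeries.coeff m (geom ^ d) = (d.multichoose m : ℤ) := by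
  cases d with
  | zero =>
    cases m <;> simp [PowerSeries.coeff_one]
  | succ d =>
    rw [geom, PowerSeries.mk_one_pow_eq_mk_choose_add, PowerSeries.coeff_mk,
      Nat.multichoose_eq, show d + 1 + m - 1 = d + m by omega, Nat.choose_symm_add]

theorem geom_pow_ne_zero (d : ℕ) : geom ^ d ≠ 0 := by
  apply pow_ne_zero
  intro h
  simpa [h] using geom_mul

/-- The generating function of `truncCoeff n k g`. -/
def truncSeries (n k g : ℕ) : PowerSeries ℤ := PowerSeries.mk (truncCoeff n k g)

theorem truncSeries_succ (n k g : ℕ) : truncSeries n k (g + 1) = truncSeries n k g * geom := by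
  ext m
  rw [coeff_mul_geom]
  simp [truncSeries, truncCoeff]

theorem truncSeries_add (n k g r : ℕ) :
    truncSeries n k (g + r) = truncSeries n k g * geom ^ r := by
  induction r with
  | zero => simp
  | succ r ih => rw [← add_assoc, truncSeries_succ, ih, pow_succ, mul_assoc]

/-- For g = n this is the numerical shadow of the exact sequence 0 → M(n, k + 1) → ⋀ᵏRⁿ → M(n, k) →
0; the factor T accounts for the shift of the initial degree. -/
theorem truncSeries_add_X_mul {n k : ℕ} (g : ℕ) :
    truncSeries n k g + PowerSeries.X * truncSeries n (k + 1) g =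
      PowerSeries.C (n.choose k : ℤ) * geom ^ g := by
  have h0 : truncSeries n k 0 + PowerSeries.X * truncSeries n (k + 1) 0 =
      PowerSeries.C (n.choose k : ℤ) := by
    ext m
    cases m with
    | zero => simp [truncSeries, truncCoeff]
    | succ m =>
      rw [map_add, PowerSeries.coeff_succ_X_mul, PowerSeries.coeff_C, if_neg (Nat.succ_ne_zero m)]
      simp only [truncSeries, truncCoeff, PowerSeries.coeff_mk, pow_succ]
      rw [show k + (m + 1) = k + 1 + m by ring]
      ring
  have h1 := truncSeries_add n k 0 g
  have h2 := truncSeries_add n (k + 1) 0 g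
  rw [zero_add] at h1 h2
  rw [h1, h2, ← h0]
  ring

theorem sum_C_mul_X_pow_mul_geom (c : ℕ → ℤ) (N : ℕ) :
    (∑ l ∈ Finset.range (N + 1), PowerSeries.C (c l) * PowerSeries.X ^ l) * geom =
      ∑ l ∈ Finset.range (N + 1),
        PowerSeries.C (∑ i ∈ Finset.range (l + 1), c i) * PowerSeries.X ^ l +
      PowerSeries.X ^ (N + 1) * (PowerSeries.C (∑ i ∈ Finset.range (N + 1), c i) * geom) := by
  have h := geom_mul
  induction N with
  | zero =>
    simp only [zero_add, Finset.sum_range_one, pow_zero, pow_one]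
    linear_combination PowerSeries.C (c 0) * h
  | succ N ih =>
    rw [Finset.sum_range_succ _ (N + 1), add_mul, ih, Finset.sum_range_succ _ (N + 1),
      Finset.sum_range_succ c (N + 1), map_add]
    linear_combination (PowerSeries.C (∑ i ∈ Finset.range (N + 1), c i) +
      PowerSeries.C (c (N + 1))) * PowerSeries.X ^ (N + 1) * h

/-- Splitting off the terms of degree at least `N` from `truncSeries n k g`. -/
theorem truncSeries_eq_trunc_add {n k N : ℕ} (hN : n ≤ k + N) (g : ℕ) :
    truncSeries n k g =
      ∑ l ∈ Finset.range (N + 1), PowerSeries.C (truncCoeff n k g l) * PowerSeries.X ^ l +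
      PowerSeries.X ^ (N + 1) * ∑ j ∈ Finset.range g,
        PowerSeries.C (truncCoeff n k (g - j) N) * geom ^ (j + 1) := by
  induction g with
  | zero =>
    ext m
    rw [Finset.range_zero, Finset.sum_empty, mul_zero, add_zero, map_sum]
    simp only [PowerSeries.coeff_C_mul, PowerSeries.coeff_X_pow, mul_ite, mul_one, mul_zero,
      Finset.sum_ite_eq, Finset.mem_range, truncSeries, PowerSeries.coeff_mk]
    split_ifs with h
    · rfl
    · simp [truncCoeff, Nat.choose_eq_zero_of_lt (by omega : n < k + m)]
  | succ g ih =>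
    rw [truncSeries_succ, ih, add_mul, sum_C_mul_X_pow_mul_geom, Finset.sum_range_succ' _ g,
      mul_assoc, Finset.sum_mul]
    simp only [Nat.add_sub_add_right, Nat.sub_zero, zero_add, pow_one, mul_add, pow_succ _ (_ + 1),
      truncCoeff, mul_assoc]
    ring

/-! ### Hilbert functions of polynomial rings and graded retracts. -/

theorem finrank_homogeneousSubmodule (K : Type*) [Field K] (d e : ℕ) :
    Module.finrank K (homogeneousSubmodule (Fin d) K e) = d.multichoose e := by
  have h : {b : Fin d →₀ ℕ | b.degree = e} =
      ((Finset.univ : Finset (Fin d)).finsuppAntidiag e : Set (Fin d →₀ ℕ)) := by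
    ext b
    simp [Finsupp.degree_eq_sum]
  rw [homogeneousSubmodule_eq_finsupp_supported, h,
    (AddMonoidAlgebra.supportedEquivFinsupp _).finrank_eq, Module.finrank_finsupp_self]
  simp [Finset.card_finsuppAntidiag_nat_eq_multichoose]

instance finiteDimensional_homogeneousSubmodule (K : Type*) [Field K] (n e : ℕ) :
    FiniteDimensional K (homogeneousSubmodule (Fin n) K e) :=
  Module.Finite.iff_fg.2 (homogeneousSubmodule_fg (Fin n) K e)

instance finiteDimensional_polyPiece (K : Type*) [Field K] (n : ℕ) (d : ℤ) :
    FiniteDimensional K (polyPiece K n d) := by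
  by_cases h : 0 ≤ d
  · rw [polyPiece, if_pos h]
    infer_instance
  · rw [polyPiece, if_neg h]
    infer_instance

theorem polyPiece_natCast (K : Type*) [Field K] (n d : ℕ) :
    polyPiece K n d = homogeneousSubmodule (Fin n) K d := by
  simp [polyPiece]

theorem polyPiece_of_neg (K : Type*) [Field K] (n : ℕ) {d : ℤ} (hd : d < 0) :
    polyPiece K n d = ⊥ := by
  simp [polyPiece, not_le.2 hd]

theorem finrank_polyPiece_natCast (K : Type*) [Field K] (n d : ℕ) :
    Module.finrank K (polyPiece K n d) = n.multichoose d := by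
  rw [polyPiece_natCast, finrank_homogeneousSubmodule]

namespace GradedRetract

variable {K : Type*} [Field K] {n : ℕ}

instance finiteDimensional_piece (S : GradedRetract K n) (d : ℤ) :
    FiniteDimensional K (S.piece d) := by
  unfold piece
  infer_instance

theorem piece_of_neg (S : GradedRetract K n) {d : ℤ} (hd : d < 0) : S.piece d = ⊥ := by
  simp [piece, polyPiece_of_neg K n hd]

theorem mem_piece_natCast (S : GradedRetract K n) (d : ℕ) (p : MvPolynomial (Fin n) K) :
    p ∈ S.piece d ↔ p ∈ S.alg ∧ p.IsHomogeneous d := by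
  simp [piece, polyPiece_natCast]

theorem numVars_le (S : GradedRetract K n) : S.numVars ≤ n := by
  have h := Submodule.finrank_mono (inf_le_right : S.piece 1 ≤ polyPiece K n 1)
  have h1 := finrank_polyPiece_natCast K n 1
  rw [Nat.cast_one, Nat.multichoose_one_right] at h1
  exact h.trans h1.le

/-- A graded retract has the Hilbert function of a polynomial ring in `numVars` variables. -/
theorem finrank_piece (S : GradedRetract K n) (e : ℕ) :
    Module.finrank K (S.piece e) = S.numVars.multichoose e := by
  obtain ⟨π, hπ, hπS⟩ := S.exists_retraction
  set d := S.numVars with hd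
  let ℓ : Module.Basis (Fin d) K (S.piece 1) := Module.finBasisOfFinrankEq K _ rfl
  have hℓ (i) := (S.mem_piece_natCast 1 (ℓ i)).1 (by simp)
  -- Λ sends the basis of linear forms of S to the variables of K[X₁, …, X_d]. Only its values on
  -- the degree-one piece of S matter; the extension merely avoids subtypes.
  obtain ⟨Λ, hΛ⟩ := (ℓ.constr K (X : Fin d → MvPolynomial (Fin d) K)).exists_extend
  have hΛ' (w : S.piece 1) : Λ w = ℓ.constr K (X : Fin d → MvPolynomial (Fin d) K) w :=
    LinearMap.congr_fun hΛ w
  have hπX (j) : (π (X j) : MvPolynomial (Fin n) K) ∈ S.piece 1 := by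
    have := (S.mem_piece_natCast 1 (π (X j))).2 ⟨(π (X j)).2, hπ _ _ (isHomogeneous_X K j)⟩
    simpa using this
  have hΛhom (w : S.piece 1) : (Λ w).IsHomogeneous 1 := by
    rw [hΛ', Module.Basis.constr_apply_fintype]
    exact IsHomogeneous.sum _ _ _ fun i _ => by
      rw [smul_eq_C_mul]
      exact isHomogeneous_C_mul_X _ _
  let φ : MvPolynomial (Fin d) K →ₐ[K] MvPolynomial (Fin n) K :=
    aeval fun i => (ℓ i : MvPolynomial (Fin n) K)
  let χ : MvPolynomial (Fin n) K →ₐ[K] MvPolynomial (Fin d) K :=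
    aeval fun j => Λ (π (X j))
  have hφΛ (w : S.piece 1) : φ (Λ w) = w := by
    rw [hΛ', Module.Basis.constr_apply_fintype, map_sum]
    have := congrArg Subtype.val (ℓ.sum_repr w)
    rw [AddSubmonoidClass.coe_finsetSum] at this
    simpa only [φ, Module.Basis.equivFun_apply, map_smul, aeval_X, Submodule.coe_smul] using this
  have hφχ : φ.comp χ = S.alg.val.comp π := by
    refine algHom_ext fun j => ?_
    simp only [AlgHom.comp_apply, χ, aeval_X]
    exact hφΛ ⟨_, hπX j⟩
  have hχ : Set.EqOn χ.toLinearMap (Λ ∘ₗ S.alg.val.toLinearMap ∘ₗ π.toLinearMap)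
      (Submodule.span K (Set.range (X : Fin n → MvPolynomial (Fin n) K))) := by
    apply LinearMap.eqOn_span
    rintro _ ⟨j, rfl⟩
    simp [χ]
  -- Together with φχ = π this makes φ an isomorphism from K[X₁, …, X_d] onto S; on linear forms χ
  -- is Λ ∘ π, and π fixes each ℓ i.
  have hχφ : χ.comp φ = AlgHom.id K _ := by
    refine algHom_ext fun i => ?_
    have h1 : (ℓ i : MvPolynomial (Fin n) K) ∈
        Submodule.span K (Set.range (X : Fin n → MvPolynomial (Fin n) K)) := by
      rw [← homogeneousSubmodule_one_eq_span_X]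
      exact (hℓ i).2
    have h2 := hχ h1
    have h3 : (π (ℓ i : MvPolynomial (Fin n) K) : MvPolynomial (Fin n) K) = ℓ i :=
      congrArg Subtype.val (hπS ⟨ℓ i, (hℓ i).1⟩)
    simp only [AlgHom.toLinearMap_apply, LinearMap.comp_apply, Subalgebra.coe_val, h3, hΛ',
      Module.Basis.constr_basis] at h2
    simpa [φ] using h2
  have hinj : Function.Injective φ.toLinearMap := fun x y hxy => by
    have := congrArg χ hxy
    have e (z) : χ (φ z) = z := AlgHom.congr_fun hχφ z
    simpa [e] using this
  have hmap : S.piece e = (homogeneousSubmodule (Fin d) K e).map φ.toLinearMap := by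
    ext p
    rw [mem_piece_natCast, Submodule.mem_map]
    constructor
    · rintro ⟨hp, hpe⟩
      refine ⟨χ p, ?_, ?_⟩
      · have := hpe.aeval (fun j => Λ (π (X j))) fun j => hΛhom ⟨_, hπX j⟩
        rwa [one_mul] at this
      · have := AlgHom.congr_fun hφχ p
        simp only [AlgHom.comp_apply, Subalgebra.coe_val] at this
        rw [AlgHom.toLinearMap_apply, this, hπS ⟨p, hp⟩]
    · rintro ⟨q, hq, rfl⟩
      refine ⟨?_, ?_⟩
      · have : φ = S.alg.val.comp (aeval fun i => (⟨ℓ i, (hℓ i).1⟩ : S.alg)) :=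
          algHom_ext fun i => by simp [φ]
        rw [AlgHom.toLinearMap_apply, this]
        exact Subtype.property _
      · have := IsHomogeneous.aeval hq (fun i => (ℓ i : MvPolynomial (Fin n) K))
          fun i => (hℓ i).2
        rwa [one_mul] at this
  rw [hmap, ← (Submodule.equivMapOfInjective _ hinj _).finrank_eq, finrank_homogeneousSubmodule]

/-- The polynomial subring in the first `d` variables. -/
def ofVars (K : Type*) [Field K] {n d : ℕ} (hd : d ≤ n) : GradedRetract K n where
  alg := (rename (Fin.castLE hd) : MvPolynomial (Fin d) K →ₐ[K] _).range
  exists_retraction := by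
    let ρ : MvPolynomial (Fin n) K →ₐ[K] MvPolynomial (Fin d) K :=
      aeval fun j => if h : (j : ℕ) < d then X ⟨j, h⟩ else 0
    refine ⟨(rename (Fin.castLE hd) : MvPolynomial (Fin d) K →ₐ[K] _).rangeRestrict.comp ρ, ?_, ?_⟩
    · intro p e hp
      have : (ρ p).IsHomogeneous (1 * e) := hp.aeval _ fun j => by
        split_ifs
        · exact isHomogeneous_X _ _
        · exact isHomogeneous_zero _ _ _
      rw [one_mul] at this
      exact this.rename_isHomogeneous
    · rintro ⟨_, q, rfl⟩
      have : ρ.comp (rename (Fin.castLE hd)) = AlgHom.id K (MvPolynomial (Fin d) K) :=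
        algHom_ext fun i => by simp [ρ]
      ext1
      have := AlgHom.congr_fun this q
      simp only [AlgHom.comp_apply, AlgHom.id_apply] at this
      exact congrArg (rename (Fin.castLE hd)) this

theorem numVars_ofVars (K : Type*) [Field K] {n d : ℕ} (hd : d ≤ n) :
    (ofVars K hd).numVars = d := by
  have hinj : Function.Injective (rename (Fin.castLE hd) : MvPolynomial (Fin d) K →ₐ[K] _).toLinearMap :=
    rename_injective _ (Fin.castLE_injective hd)
  have : (ofVars K hd).piece 1 = (homogeneousSubmodule (Fin d) K 1).map
      (rename (Fin.castLE hd) : MvPolynomial (Fin d) K →ₐ[K] _).toLinearMap := by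
    ext p
    have h := mem_piece_natCast (ofVars K hd) 1 p
    rw [Nat.cast_one] at h
    rw [h, Submodule.mem_map]
    constructor
    · rintro ⟨⟨q, rfl⟩, hp⟩
      exact ⟨q, (IsHomogeneous.rename_isHomogeneous_iff (Fin.castLE_injective hd)).1 hp, rfl⟩
    · rintro ⟨q, hq, rfl⟩
      exact ⟨⟨q, rfl⟩, IsHomogeneous.rename_isHomogeneous hq⟩
  rw [numVars, this, ← (Submodule.equivMapOfInjective _ hinj _).finrank_eq,
    finrank_homogeneousSubmodule, Nat.multichoose_one_right]

end GradedRetract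

/-! ### A contracting homotopy for the Koszul complex. -/

section

variable {K : Type*} [Field K] {n : ℕ}

theorem koszulD_apply (f : Koszul K n) (T : Finset (Fin n)) :
    koszulD K n f T =
      ∑ i ∈ Tᶜ, (-1) ^ (T.filter (· < i)).card * X i * f (insert i T) := rfl

theorem koszulD_koszulD (f : Koszul K n) : koszulD K n (koszulD K n f) = 0 := by
  funext T
  have hsgn (i j : Fin n) (hi : i ∉ T) :
      ((-1) ^ ((insert i T).filter (· < j)).card : MvPolynomial (Fin n) K) =
        (-1) ^ (T.filter (· < j)).card * if i < j then -1 else 1 := by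
    rw [Finset.filter_insert]
    split_ifs with h
    · rw [Finset.card_insert_of_notMem (by simp [hi]), pow_succ]
    · simp
  simp only [koszulD_apply, Finset.mul_sum, Pi.zero_apply]
  rw [Finset.sum_sigma']
  refine Finset.sum_involution (fun a _ => ⟨a.2, a.1⟩) ?_ ?_ ?_ ?_
  · rintro ⟨i, j⟩ h
    simp only [Finset.mem_sigma, Finset.mem_compl, Finset.mem_insert, not_or] at h
    obtain ⟨hi, hji, hj⟩ := h
    simp only [hsgn i j hi, hsgn j i hj, Finset.insert_comm j i]
    rcases lt_or_gt_of_ne hji with h | h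
    · simp only [h, h.not_gt, if_true, if_false]
      ring
    · simp only [h, h.not_gt, if_true, if_false]
      ring
  · rintro ⟨i, j⟩ h _ e
    simp only [Finset.mem_sigma, Finset.mem_compl, Finset.mem_insert, not_or] at h
    simp only [Sigma.mk.injEq] at e
    exact h.2.1 e.1
  · rintro ⟨i, j⟩ h
    simp only [Finset.mem_sigma, Finset.mem_compl, Finset.mem_insert, not_or] at h ⊢
    exact ⟨h.2.2, Ne.symm h.2.1, h.1⟩
  · rintro ⟨i, j⟩ _
    rfl

open Classical in
/-- Division by `Xₜ` of the monomials whose first variable is `Xₜ`; the others go to `0`. -/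
def divFirst (t : Fin n) : MvPolynomial (Fin n) K →ₗ[K] MvPolynomial (Fin n) K :=
  (basisMonomials (Fin n) K).constr K fun b =>
    if (∀ j < t, b j = 0) ∧ b t ≠ 0 then monomial (b - Finsupp.single t 1) 1 else 0

open Classical in
/-- Setting to `0` the variables before `Xₜ`. -/
def killBefore (t : Fin n) : MvPolynomial (Fin n) K →ₗ[K] MvPolynomial (Fin n) K :=
  (basisMonomials (Fin n) K).constr K fun b =>
    if ∀ j < t, b j = 0 then monomial b 1 else 0

open Classical in
theorem divFirst_monomial (t : Fin n) (b : Fin n →₀ ℕ) :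
    divFirst t (monomial b (1 : K)) =
      if (∀ j < t, b j = 0) ∧ b t ≠ 0 then monomial (b - Finsupp.single t 1) 1 else 0 := by
  have := (basisMonomials (Fin n) K).constr_basis K (fun b =>
    if (∀ j < t, b j = 0) ∧ b t ≠ 0 then monomial (b - Finsupp.single t 1) (1 : K) else 0) b
  rwa [coe_basisMonomials] at this

open Classical in
theorem killBefore_monomial (t : Fin n) (b : Fin n →₀ ℕ) :
    killBefore t (monomial b (1 : K)) = if ∀ j < t, b j = 0 then monomial b 1 else 0 := by
  have := (basisMonomials (Fin n) K).constr_basis K (fun b =>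
    if ∀ j < t, b j = 0 then monomial b (1 : K) else 0) b
  rwa [coe_basisMonomials] at this

theorem linearMap_eq_of_monomial {V : Type*} [AddCommGroup V] [Module K V]
    {F G : MvPolynomial (Fin n) K →ₗ[K] V}
    (h : ∀ b : Fin n →₀ ℕ, F (monomial b 1) = G (monomial b 1)) (p : MvPolynomial (Fin n) K) :
    F p = G p := by
  have : F = G := (basisMonomials (Fin n) K).ext fun b => by simpa using h b
  rw [this]

theorem X_mul_monomial (i : Fin n) (b : Fin n →₀ ℕ) :
    X i * monomial b (1 : K) = monomial (Finsupp.single i 1 + b) 1 := by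
  rw [X, monomial_mul, one_mul]

theorem X_mul_divFirst_monomial (i : Fin n) (b : Fin n →₀ ℕ)
    [Decidable ((∀ j < i, b j = 0) ∧ b i ≠ 0)] :
    X i * divFirst i (monomial b (1 : K)) =
      if (∀ j < i, b j = 0) ∧ b i ≠ 0 then monomial b 1 else 0 := by
  rw [divFirst_monomial]
  split_ifs with h
  · rw [X_mul_monomial, add_tsub_cancel_of_le]
    rw [Finsupp.single_le_iff]
    have := h.2
    omega
  · simp

/-- A monomial is reproduced once, by its first variable, if that variable precedes Xₜ; the
monomials that involve no earlier variable are those kept by `killBefore`. -/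
theorem sum_X_mul_divFirst (t : Fin n) (p : MvPolynomial (Fin n) K) :
    ∑ i ∈ Finset.Iio t, X i * divFirst i p = p - killBefore t p := by
  classical
  have key := linearMap_eq_of_monomial
    (F := ∑ i ∈ Finset.Iio t, LinearMap.mulLeft K (X i) ∘ₗ divFirst i)
    (G := LinearMap.id - killBefore t) (fun b => ?_) p
  · simpa using key
  · simp only [LinearMap.sum_apply, LinearMap.comp_apply, LinearMap.mulLeft_apply,
      LinearMap.sub_apply, LinearMap.id_apply, X_mul_divFirst_monomial, killBefore_monomial]
    by_cases h : ∀ j < t, b j = 0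
    · rw [if_pos h, sub_self]
      refine Finset.sum_eq_zero fun i hi => if_neg fun hi' => hi'.2 (h i (Finset.mem_Iio.1 hi))
    · rw [if_neg h, sub_zero]
      push Not at h
      obtain ⟨j, hj, hbj⟩ := h
      have hne : (b.support).Nonempty := ⟨j, by simpa using hbj⟩
      have hmin : b.support.min' hne ∈ b.support := Finset.min'_mem _ _
      have hlt (i) (hi : i < b.support.min' hne) : b i = 0 := by
        by_contra hb
        exact absurd (Finset.min'_le b.support i (by simpa using hb)) (not_le.2 hi)
      rw [Finset.sum_eq_single (b.support.min' hne)]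
      · rw [if_pos ⟨hlt, by simpa using hmin⟩]
      · intro i _ hi
        refine if_neg fun h => ?_
        rcases lt_or_gt_of_ne hi with h1 | h1
        · exact h.2 (hlt i h1)
        · exact (by simpa using hmin : b _ ≠ 0) (h.1 _ h1)
      · intro h
        exact absurd (Finset.mem_Iio.2
          ((Finset.min'_le b.support j (by simpa using hbj)).trans_lt hj)) h

theorem divFirst_X_mul_self (t : Fin n) (p : MvPolynomial (Fin n) K) :
    divFirst t (X t * p) = killBefore t p := by
  classical
  refine linearMap_eq_of_monomial
    (F := divFirst t ∘ₗ LinearMap.mulLeft K (X t)) (G := killBefore t) (fun b => ?_) p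
  simp only [LinearMap.comp_apply, LinearMap.mulLeft_apply, X_mul_monomial, divFirst_monomial,
    killBefore_monomial]
  refine if_congr ?_ (by rw [add_tsub_cancel_left]) rfl
  simp only [Finsupp.add_apply, Finsupp.single_eq_same, ne_eq, Nat.add_eq_zero_iff, one_ne_zero,
    false_and, not_false_eq_true, and_true]
  exact forall₂_congr fun j hj => by simp [Finsupp.single_eq_of_ne hj.ne]

theorem divFirst_X_mul_of_lt {t i : Fin n} (h : t < i) (p : MvPolynomial (Fin n) K) :
    divFirst t (X i * p) = X i * divFirst t p := by
  classical
  refine linearMap_eq_of_monomial (F := divFirst t ∘ₗ LinearMap.mulLeft K (X i))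
    (G := LinearMap.mulLeft K (X i) ∘ₗ divFirst t) (fun b => ?_) p
  have e (j) (hj : j ≤ t) : (Finsupp.single i 1 + b : Fin n →₀ ℕ) j = b j := by
    simp [Finsupp.single_eq_of_ne (hj.trans_lt h).ne]
  simp only [LinearMap.comp_apply, LinearMap.mulLeft_apply, X_mul_monomial, divFirst_monomial]
  rw [mul_ite, mul_zero, X_mul_monomial]
  refine if_ctx_congr ?_ (fun hb => ?_) fun _ => rfl
  · rw [e t le_rfl, forall₂_congr fun j (hj : j < t) => by rw [e j hj.le]]
  · rw [add_tsub_assoc_of_le]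
    rw [Finsupp.single_le_iff]
    have := hb.2
    omega

theorem divFirst_X_mul_of_gt {t i : Fin n} (h : i < t) (p : MvPolynomial (Fin n) K) :
    divFirst t (X i * p) = 0 := by
  classical
  refine linearMap_eq_of_monomial (F := divFirst t ∘ₗ LinearMap.mulLeft K (X i))
    (G := 0) (fun b => ?_) p
  simp only [LinearMap.comp_apply, LinearMap.mulLeft_apply, X_mul_monomial, divFirst_monomial,
    LinearMap.zero_apply]
  refine if_neg fun hb => ?_
  simpa using hb.1 i h

theorem divFirst_mem_polyPiece (t : Fin n) {d : ℤ} {p : MvPolynomial (Fin n) K}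
    (hp : p ∈ polyPiece K n d) : divFirst t p ∈ polyPiece K n (d - 1) := by
  classical
  rcases lt_or_ge d 0 with hd | hd
  · rw [polyPiece_of_neg K n hd, Submodule.mem_bot] at hp
    simp [hp]
  lift d to ℕ using hd
  rw [polyPiece_natCast] at hp
  rw [p.as_sum, map_sum]
  refine Submodule.sum_mem _ fun b hb => ?_
  have hdeg : b.degree = d := by
    by_contra h
    exact (mem_support_iff.1 hb) (hp.coeff_eq_zero h)
  rw [show monomial b (coeff b p) = coeff b p • monomial b (1 : K) by simp [smul_monomial],
    map_smul, divFirst_monomial]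
  refine Submodule.smul_mem _ _ ?_
  split_ifs with h
  · have hle : Finsupp.single t 1 ≤ b := by
      rw [Finsupp.single_le_iff]
      have := h.2
      omega
    have hb' : (b - Finsupp.single t 1).degree + 1 = d := by
      rw [← hdeg]
      conv_rhs => rw [← tsub_add_cancel_of_le hle]
      simp
    rw [show (d : ℤ) - 1 = ((b - Finsupp.single t 1).degree : ℕ) by omega, polyPiece_natCast]
    exact isHomogeneous_monomial _ rfl
  · exact zero_mem _

/-- The contracting homotopy of the Koszul complex. -/
def koszulHomotopy (f : Koszul K n) : Koszul K n := fun S =>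
  if hS : S.Nonempty then divFirst (S.min' hS) (f (S.erase (S.min' hS))) else 0

theorem koszulHomotopy_insert (f : Koszul K n) {T : Finset (Fin n)} {i : Fin n}
    (hi : ∀ j ∈ T, i < j) : koszulHomotopy f (insert i T) = divFirst i (f T) := by
  have hmin : (insert i T).min' (Finset.insert_nonempty i T) = i := by
    refine le_antisymm (Finset.min'_le _ _ (Finset.mem_insert_self _ _)) ?_
    refine Finset.le_min' _ _ _ fun j hj => ?_
    rcases Finset.mem_insert.1 hj with rfl | hj
    · exact le_rfl
    · exact (hi j hj).le
  rw [koszulHomotopy, dif_pos (Finset.insert_nonempty i T), hmin,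
    Finset.erase_insert fun h => lt_irrefl _ (hi i h)]

/-- Let t = min T and T = {t} ∪ U. In ∂h the indices i < t contribute all of f T except `killBefore
t (f T)`, which is the contribution of i = t in h∂. The indices i > t occur in both with opposite
signs, because t is one more element of T below i. -/
theorem koszulD_koszulHomotopy_add (f : Koszul K n) {T : Finset (Fin n)} (hT : T.Nonempty) :
    koszulD K n (koszulHomotopy f) T + koszulHomotopy (koszulD K n f) T = f T := by
  obtain ⟨t, U, hU, rfl⟩ : ∃ t U, (∀ j ∈ U, t < j) ∧ T = insert t U := by
    refine ⟨T.min' hT, T.erase (T.min' hT), fun j hj => ?_,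
      (Finset.insert_erase (Finset.min'_mem _ _)).symm⟩
    exact Finset.min'_lt_of_mem_erase_min' _ _ hj
  have htU : t ∉ U := fun h => lt_irrefl _ (hU t h)
  have hc : (insert t U)ᶜ = Finset.Iio t ∪ (Uᶜ ∩ Finset.Ioi t) := by
    ext j
    simp only [Finset.mem_compl, Finset.mem_insert, not_or, Finset.mem_union, Finset.mem_Iio,
      Finset.mem_inter, Finset.mem_Ioi]
    constructor
    · rintro ⟨h1, h2⟩
      rcases lt_or_gt_of_ne h1 with h | h
      · exact Or.inl h
      · exact Or.inr ⟨h2, h⟩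
    · rintro (h | ⟨h1, h2⟩)
      · exact ⟨h.ne, fun hj => (hU j hj).not_gt h⟩
      · exact ⟨h2.ne', h1⟩
  have hdisj : Disjoint (Finset.Iio t) (Uᶜ ∩ Finset.Ioi t) := by
    rw [Finset.disjoint_left]
    intro j h1 h2
    simp only [Finset.mem_Iio, Finset.mem_inter, Finset.mem_Ioi] at h1 h2
    exact h1.not_gt h2.2
  have hc' : Uᶜ = insert t (insert t U)ᶜ := by
    ext j
    by_cases h : j = t <;> simp [h, htU]
  have hVmem : ∀ i ∈ Uᶜ ∩ Finset.Ioi t, t < i := fun i hi =>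
    Finset.mem_Ioi.1 (Finset.mem_inter.1 hi).2
  rw [hc] at hc'
  generalize Uᶜ ∩ Finset.Ioi t = V at hc hdisj hc' hVmem
  have e1 : koszulD K n (koszulHomotopy f) (insert t U) = f (insert t U) -
      killBefore t (f (insert t U)) + ∑ i ∈ V,
        (-1) ^ (U.filter (· < i)).card * -(X i * divFirst t (f (insert i U))) := by
    rw [koszulD_apply, hc, Finset.sum_union hdisj, ← sum_X_mul_divFirst]
    refine congrArg₂ _ (Finset.sum_congr rfl fun i hi => ?_) (Finset.sum_congr rfl fun i hi => ?_)
    · have hi := Finset.mem_Iio.1 hi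
      have hlt : ∀ j ∈ insert t U, i < j := by
        intro j hj
        rcases Finset.mem_insert.1 hj with rfl | hj
        · exact hi
        · exact hi.trans (hU j hj)
      rw [koszulHomotopy_insert f hlt, Finset.filter_false_of_mem fun j hj => (hlt j hj).not_gt]
      simp
    · have hti := hVmem i hi
      have hlt : ∀ j ∈ insert i U, t < j := by
        intro j hj
        rcases Finset.mem_insert.1 hj with rfl | hj
        · exact hti
        · exact hU j hj
      rw [Finset.insert_comm, koszulHomotopy_insert f hlt, Finset.filter_insert, if_pos hti,
        Finset.card_insert_of_notMem (by simp [htU])]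
      ring
  have e2 : koszulHomotopy (koszulD K n f) (insert t U) = killBefore t (f (insert t U)) +
      ∑ i ∈ V,
        (-1) ^ (U.filter (· < i)).card * (X i * divFirst t (f (insert i U))) := by
    have hpow (m : ℕ) (p : MvPolynomial (Fin n) K) :
        divFirst t ((-1) ^ m * p) = (-1) ^ m * divFirst t p := by
      rcases neg_one_pow_eq_or (MvPolynomial (Fin n) K) m with e | e <;> simp [e]
    rw [koszulHomotopy_insert _ hU, koszulD_apply, hc',
      Finset.sum_insert (by simpa using fun h => lt_irrefl _ (hVmem t h)), Finset.sum_union hdisj]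
    simp only [map_add, map_sum, mul_assoc, hpow]
    rw [Finset.filter_false_of_mem fun j hj => (hU j hj).not_gt, Finset.card_empty, pow_zero,
      one_mul, divFirst_X_mul_self]
    rw [Finset.sum_eq_zero (s := Finset.Iio t) fun i hi => by
      rw [divFirst_X_mul_of_gt (Finset.mem_Iio.1 hi), mul_zero], zero_add]
    refine congrArg₂ _ rfl (Finset.sum_congr rfl fun i hi => ?_)
    rw [divFirst_X_mul_of_lt (hVmem i hi)]
  rw [e1, e2]
  simp only [mul_neg, Finset.sum_neg_distrib]
  ring

end

/-! ### Exactness in each degree and the Hilbert function of M(n, k). -/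

section

variable {K : Type*} [Field K] {n : ℕ}

theorem mem_koszulPiece {d : ℤ} {f : Koszul K n} :
    f ∈ koszulPiece K n d ↔ ∀ S : Finset (Fin n), f S ∈ polyPiece K n (d - S.card) := by
  simp [koszulPiece, Submodule.mem_pi]

theorem X_mul_mem_polyPiece (i : Fin n) {d : ℤ} {p : MvPolynomial (Fin n) K}
    (hp : p ∈ polyPiece K n (d - 1)) : X i * p ∈ polyPiece K n d := by
  rcases lt_or_ge (d - 1) 0 with hd | hd
  · rw [polyPiece_of_neg K n hd, Submodule.mem_bot] at hp
    simp [hp]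
  obtain ⟨e, he⟩ := Int.eq_ofNat_of_zero_le hd
  obtain rfl : d = ((1 + e : ℕ) : ℤ) := by push_cast; linarith
  rw [he, polyPiece_natCast] at hp
  rw [polyPiece_natCast]
  exact (isHomogeneous_X K i).mul hp

theorem koszulD_mem_koszulTerm {k : ℕ} {f : Koszul K n} (hf : f ∈ koszulTerm K n (k + 1)) :
    koszulD K n f ∈ koszulTerm K n k := by
  intro T hT
  rw [koszulD_apply]
  refine Finset.sum_eq_zero fun i hi => ?_
  rw [hf, mul_zero]
  rw [Finset.card_insert_of_notMem (Finset.mem_compl.1 hi)]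
  omega

theorem koszulD_mem_koszulPiece {d : ℤ} {f : Koszul K n} (hf : f ∈ koszulPiece K n d) :
    koszulD K n f ∈ koszulPiece K n d := by
  rw [mem_koszulPiece] at hf ⊢
  intro T
  rw [koszulD_apply]
  refine Submodule.sum_mem _ fun i hi => ?_
  have h := hf (insert i T)
  rw [Finset.card_insert_of_notMem (Finset.mem_compl.1 hi), Nat.cast_succ, ← sub_sub] at h
  have h := X_mul_mem_polyPiece i h
  rw [mul_assoc]
  rcases neg_one_pow_eq_or (MvPolynomial (Fin n) K) (T.filter (· < i)).card with e | e
  · simpa [e] using h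
  · simpa [e] using h

theorem koszulHomotopy_mem_koszulTerm {k : ℕ} {f : Koszul K n} (hf : f ∈ koszulTerm K n k) :
    koszulHomotopy f ∈ koszulTerm K n (k + 1) := by
  intro S hS
  rw [koszulHomotopy]
  split_ifs with h
  · rw [hf, map_zero]
    rw [Finset.card_erase_of_mem (Finset.min'_mem _ _)]
    have := h.card_pos
    omega
  · rfl

theorem koszulHomotopy_mem_koszulPiece {d : ℤ} {f : Koszul K n} (hf : f ∈ koszulPiece K n d) :
    koszulHomotopy f ∈ koszulPiece K n d := by
  rw [mem_koszulPiece] at hf ⊢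
  intro S
  rw [koszulHomotopy]
  split_ifs with h
  · have h1 := divFirst_mem_polyPiece (S.min' h) (hf (S.erase (S.min' h)))
    rw [Finset.card_erase_of_mem (Finset.min'_mem _ _), Nat.cast_sub h.card_pos] at h1
    convert h1 using 2
    push_cast
    ring
  · exact zero_mem _

/-- The homotopy identity is available only at nonempty T; at the empty set both sides vanish
because k ≥ 1. -/
theorem koszulD_koszulHomotopy {k : ℕ} (hk : 1 ≤ k) {f : Koszul K n}
    (hf : f ∈ koszulTerm K n k) (hD : koszulD K n f = 0) :
    koszulD K n (koszulHomotopy f) = f := by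
  funext T
  rcases T.eq_empty_or_nonempty with rfl | hT
  · have h : (∅ : Finset (Fin n)).card ≠ k := by
      rw [Finset.card_empty]
      omega
    rw [hf _ h, koszulD_mem_koszulTerm (koszulHomotopy_mem_koszulTerm hf) _ h]
  · have h := koszulD_koszulHomotopy_add f hT
    have h0 : koszulHomotopy (0 : Koszul K n) T = 0 := by
      rw [koszulHomotopy]
      split_ifs
      · simp
    rwa [hD, h0, add_zero] at h

/-- The degree `d` component of `⋀ᵏ Rⁿ`. -/
def koszulTermPiece (K : Type*) [Field K] (n k : ℕ) (d : ℤ) : Submodule K (Koszul K n) :=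
  (koszulTerm K n k).restrictScalars K ⊓ koszulPiece K n d

/-- An element of `⋀ᵏ Rⁿ` of degree `d` is given by its coefficients. -/
def koszulTermPieceEquiv (K : Type*) [Field K] (n k : ℕ) (d : ℤ) :
    koszulTermPiece K n k d ≃ₗ[K]
      ({S : Finset (Fin n) // S.card = k} → polyPiece K n (d - k)) where
  toFun f S := ⟨f.1 S.1, by simpa [S.2] using mem_koszulPiece.1 f.2.2 S.1⟩
  map_add' _ _ := rfl
  map_smul' _ _ := rfl
  invFun g := ⟨fun S => if h : S.card = k then g ⟨S, h⟩ else 0, by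
    refine ⟨fun S hS => dif_neg hS, mem_koszulPiece.2 fun S => ?_⟩
    split_ifs with h
    · subst h
      exact (g ⟨S, rfl⟩).2
    · exact zero_mem _⟩
  left_inv f := by
    ext1
    funext S
    by_cases h : S.card = k
    · simp [h]
    · simpa [h] using (f.2.1 S h).symm
  right_inv g := by
    funext S
    ext1
    simp [S.2]

instance finiteDimensional_koszulTermPiece (k : ℕ) (d : ℤ) :
    FiniteDimensional K (koszulTermPiece K n k d) :=
  Module.Finite.equiv (koszulTermPieceEquiv K n k d).symm

theorem finrank_koszulTermPiece (k : ℕ) (d : ℤ) :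
    Module.finrank K (koszulTermPiece K n k d) =
      n.choose k * Module.finrank K (polyPiece K n (d - k)) := by
  rw [(koszulTermPieceEquiv K n k d).finrank_eq, Module.finrank_pi_fintype]
  simp

/-- A homogeneous element of the image has a homogeneous preimage, namely the one given by the
homotopy. This uses exactness at ⋀ᵏ⁻¹Rⁿ, hence k ≥ 2. -/
theorem syzygyPiece_eq_map {k : ℕ} (hk : 2 ≤ k) (d : ℤ) :
    syzygyPiece K n k d =
      (koszulTermPiece K n k d).map ((koszulD K n).restrictScalars K) := by
  obtain ⟨k, rfl⟩ : ∃ j, k = j + 1 := ⟨k - 1, by omega⟩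
  ext y
  constructor
  · rintro ⟨⟨f, hf, rfl⟩, hy⟩
    have h1 := koszulD_mem_koszulTerm hf
    refine ⟨koszulHomotopy (koszulD K n f), ⟨koszulHomotopy_mem_koszulTerm h1,
      koszulHomotopy_mem_koszulPiece hy⟩, ?_⟩
    exact koszulD_koszulHomotopy (by omega) h1 (koszulD_koszulD f)
  · rintro ⟨f, ⟨hf, hfd⟩, rfl⟩
    exact ⟨⟨f, hf, rfl⟩, koszulD_mem_koszulPiece hfd⟩

theorem finiteDimensional_syzygyPiece {k : ℕ} (hk : 2 ≤ k) (d : ℤ) :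
    FiniteDimensional K (syzygyPiece K n k d) := by
  rw [syzygyPiece_eq_map hk]
  infer_instance

theorem ker_koszulD_eq {k : ℕ} (hk : 1 ≤ k) (d : ℤ) :
    LinearMap.ker ((koszulD K n).restrictScalars K) ⊓ koszulTermPiece K n k d =
      syzygyPiece K n (k + 1) d := by
  ext f
  constructor
  · rintro ⟨hD, hf, hfd⟩
    exact ⟨⟨koszulHomotopy f, koszulHomotopy_mem_koszulTerm hf, koszulD_koszulHomotopy hk hf hD⟩,
      hfd⟩
  · rintro ⟨⟨f, hf, rfl⟩, hfd⟩
    exact ⟨koszulD_koszulD f, koszulD_mem_koszulTerm hf, hfd⟩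

/-- Rank-nullity for ∂ on the degree d piece of ⋀ᵏRⁿ, whose kernel is the next syzygy module by
exactness. -/
theorem finrank_syzygyPiece_add {k : ℕ} (hk : 2 ≤ k) (d : ℤ) :
    Module.finrank K (syzygyPiece K n k d) + Module.finrank K (syzygyPiece K n (k + 1) d) =
      n.choose k * Module.finrank K (polyPiece K n (d - k)) := by
  have h := LinearMap.finrank_range_add_finrank_ker
    (((koszulD K n).restrictScalars K).domRestrict (koszulTermPiece K n k d))
  rw [finrank_koszulTermPiece, LinearMap.range_domRestrict, LinearMap.ker_domRestrict,
    ← syzygyPiece_eq_map hk] at h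
  rw [← h, ← ker_koszulD_eq (by omega : 1 ≤ k), inf_comm, ← Submodule.map_comap_subtype,
    ← (Submodule.equivSubtypeMap _ _).finrank_eq]

theorem syzygyPiece_eq_bot {k : ℕ} (hk : n < k) (d : ℤ) : syzygyPiece K n k d = ⊥ := by
  rw [eq_bot_iff]
  rintro _ ⟨⟨f, hf, rfl⟩, -⟩
  have : f = 0 := by
    funext S
    refine hf S fun h => ?_
    have := S.card_le_univ
    rw [Fintype.card_fin] at this
    omega
  simp [this]

theorem truncCoeff_eq_zero {n k : ℕ} (hk : n < k) (g m : ℕ) : truncCoeff n k g m = 0 := by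
  induction g generalizing m with
  | zero => simp [truncCoeff, Nat.choose_eq_zero_of_lt (by omega : n < k + m)]
  | succ g ih => simp [truncCoeff, ih]

/-- The Hilbert function of `M(n, k)`. -/
theorem finrank_syzygyPiece {k : ℕ} (hk : 2 ≤ k) (d : ℤ) :
    (Module.finrank K (syzygyPiece K n k d) : ℤ) =
      if d < k then 0 else truncCoeff n k n (d - k).toNat := by
  rcases lt_or_ge n k with h | h
  · rw [syzygyPiece_eq_bot h, truncCoeff_eq_zero h]
    simp
  have ih := finrank_syzygyPiece (k := k + 1) (by omega) d
  have hadd := finrank_syzygyPiece_add (K := K) (n := n) hk d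
  split_ifs with hd
  · rw [polyPiece_of_neg K n (by linarith), finrank_bot, mul_zero] at hadd
    omega
  obtain ⟨m, hm⟩ : ∃ m : ℕ, d = k + m := ⟨(d - k).toNat, by omega⟩
  -- Dimensions and coefficients obey the same two-term relation between k and k + 1, so descending
  -- induction from k > n, where both vanish, identifies them.
  have e := congrArg (PowerSeries.coeff m) (truncSeries_add_X_mul (n := n) (k := k) n)
  rw [PowerSeries.coeff_C_mul, coeff_geom_pow, map_add] at e
  rw [hm, add_sub_cancel_left] at hadd ⊢
  rw [hm] at ih
  rw [finrank_polyPiece_natCast] at hadd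
  rw [Int.toNat_natCast]
  zify at hadd
  cases m with
  | zero =>
    rw [if_pos (by push_cast; linarith)] at ih
    simp [truncSeries] at e
    rw [ih, add_zero] at hadd
    rw [hadd]
    simp [e]
  | succ m =>
    rw [if_neg (by push_cast; linarith)] at ih
    rw [PowerSeries.coeff_succ_X_mul] at e
    simp only [truncSeries, PowerSeries.coeff_mk] at e
    rw [show ((k : ℤ) + (m + 1 : ℕ) - (k + 1 : ℕ)).toNat = m by omega] at ih
    linarith
termination_by n + 1 - k

end

/-! ### Hilbert decompositions and nonnegative coefficients. -/

section

variable {K : Type*} [Field K] {n : ℕ}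

theorem GradedRetract.finrank_piece_int (S : GradedRetract K n) (e : ℤ) :
    Module.finrank K (S.piece e) = if e < 0 then 0 else S.numVars.multichoose e.toNat := by
  split_ifs with h
  · rw [S.piece_of_neg h, finrank_bot]
  · obtain ⟨m, rfl⟩ := Int.eq_ofNat_of_zero_le (not_lt.1 h)
    exact S.finrank_piece m

theorem HilbertDecomposition.finrank_eq {V : Type*} [AddCommGroup V] [Module K V]
    {𝓜 : ℤ → Submodule K V} (H : HilbertDecomposition n 𝓜) (d : ℤ) :
    Module.finrank K (𝓜 d) = ∑ i, Module.finrank K ((H.retract i).piece (d - H.shift i)) := by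
  obtain ⟨e⟩ := H.iso d
  rw [e.finrank_eq, Module.finrank_pi_fintype]

theorem coeff_X_pow_mul_geom_pow (t d m : ℕ) :
    PowerSeries.coeff m (PowerSeries.X ^ t * geom ^ d) =
      if t ≤ m then (d.multichoose (m - t) : ℤ) else 0 := by
  rw [PowerSeries.coeff_X_pow_mul', coeff_geom_pow]

theorem coeff_X_pow_mul_geom_pow_nonneg (t d m : ℕ) :
    0 ≤ PowerSeries.coeff m (PowerSeries.X ^ t * geom ^ d) := by
  rw [coeff_X_pow_mul_geom_pow]
  positivity

/-- The generating function identity equivalent to a Hilbert decomposition of `M(n, k)`. -/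
theorem truncSeries_eq_sum {k : ℕ} (hk : 2 ≤ k)
    (H : HilbertDecomposition n (syzygyPiece K n k)) :
    ∃ t : Fin H.size → ℕ, truncSeries n k n =
      ∑ i, PowerSeries.X ^ t i * geom ^ (H.retract i).numVars := by
  -- Each summand has dimension 1 in the degree of its shift, while M(n, k) vanishes below degree k.
  have hshift (i) : (k : ℤ) ≤ H.shift i := by
    by_contra h
    have h1 := finrank_syzygyPiece (K := K) (n := n) hk (H.shift i)
    rw [if_pos (not_le.1 h), H.finrank_eq] at h1
    have h2 := Finset.single_le_sum
      (f := fun j => Module.finrank K ((H.retract j).piece (H.shift i - H.shift j)))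
      (fun _ _ => Nat.zero_le _) (Finset.mem_univ i)
    have h3 : Module.finrank K ((H.retract i).piece (H.shift i - H.shift i)) = 1 := by
      rw [sub_self, GradedRetract.finrank_piece_int, if_neg (lt_irrefl _), Int.toNat_zero,
        Nat.multichoose_zero_right]
    omega
  refine ⟨fun i => (H.shift i - k).toNat, ?_⟩
  ext m
  have h1 := finrank_syzygyPiece (K := K) (n := n) hk (k + m)
  rw [if_neg (by omega), add_sub_cancel_left, Int.toNat_natCast, H.finrank_eq] at h1
  rw [truncSeries, PowerSeries.coeff_mk, ← h1, map_sum]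
  push_cast
  refine Finset.sum_congr rfl fun i _ => ?_
  have hi := hshift i
  rw [GradedRetract.finrank_piece_int, coeff_X_pow_mul_geom_pow]
  split_ifs with h2 h3 h3
  · omega
  · rfl
  · rw [show ((k : ℤ) + m - H.shift i).toNat = m - (H.shift i - k).toNat by omega]
  · omega

/-- Multiplication by (1 - T)^r turns every summand T^t / (1 - T)^d, d ≥ r, into a series that still
has nonnegative coefficients. -/
theorem truncCoeff_nonneg_of_decomposition {k r : ℕ} (hk : 2 ≤ k) (hr : r ≤ n)
    (H : HilbertDecomposition n (syzygyPiece K n k)) (hH : ∀ i, r ≤ (H.retract i).numVars)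
    (m : ℕ) : 0 ≤ truncCoeff n k (n - r) m := by
  obtain ⟨t, ht⟩ := truncSeries_eq_sum hk H
  have h1 := truncSeries_add n k (n - r) r
  rw [Nat.sub_add_cancel hr, ht] at h1
  have h2 : truncSeries n k (n - r) =
      ∑ i, PowerSeries.X ^ t i * geom ^ ((H.retract i).numVars - r) := by
    refine mul_right_cancel₀ (geom_pow_ne_zero r) (h1.symm.trans ?_)
    rw [Finset.sum_mul]
    refine Finset.sum_congr rfl fun i _ => ?_
    rw [mul_assoc, ← pow_add, Nat.sub_add_cancel (hH i)]
  have h3 := congrArg (PowerSeries.coeff m) h2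
  rw [truncSeries, PowerSeries.coeff_mk, map_sum] at h3
  rw [h3]
  exact Finset.sum_nonneg fun i _ => coeff_X_pow_mul_geom_pow_nonneg _ _ _

/-- Splitting P(T) / (1 - T)^(n - r) at degree n - k gives a polynomial, nonnegative by hypothesis,
and a tail in powers of 1 / (1 - T). The tail coefficients have index n - k and positive exponent,
so they lie in the range of `truncCoeff_nonneg_of_lt`. The remaining factor 1 / (1 - T)^r brings all
exponents into [r, n]. -/
theorem truncSeries_mem_closure {k r : ℕ} (hkn : k ≤ n) (hr : r ≤ n)
    (h : ∀ m, 0 ≤ truncCoeff n k (n - r) m) :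
    truncSeries n k n ∈ AddSubmonoid.closure
      {A : PowerSeries ℤ | ∃ t d : ℕ, r ≤ d ∧ d ≤ n ∧ A = PowerSeries.X ^ t * geom ^ d} := by
  have hC (c : ℤ) (hc : 0 ≤ c) (t d : ℕ) (h1 : r ≤ d) (h2 : d ≤ n) :
      PowerSeries.C c * (PowerSeries.X ^ t * geom ^ d) ∈ AddSubmonoid.closure
      {A : PowerSeries ℤ | ∃ t d : ℕ, r ≤ d ∧ d ≤ n ∧ A = PowerSeries.X ^ t * geom ^ d} := by
    lift c to ℕ using hc
    have : PowerSeries.C (c : ℤ) * (PowerSeries.X ^ t * geom ^ d) =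
        c • (PowerSeries.X ^ t * geom ^ d) := by simp [nsmul_eq_mul]
    rw [this]
    refine AddSubmonoid.nsmul_mem _ (AddSubmonoid.subset_closure ?_) _
    exact ⟨t, d, h1, h2, rfl⟩
  have h1 := truncSeries_add n k (n - r) r
  rw [Nat.sub_add_cancel hr] at h1
  rw [h1, truncSeries_eq_trunc_add (N := n - k) (by omega) (n - r), add_mul, Finset.sum_mul,
    mul_assoc, Finset.sum_mul, Finset.mul_sum]
  refine add_mem (sum_mem fun l _ => ?_) (sum_mem fun j hj => ?_)
  · rw [mul_assoc]
    exact hC _ (h l) l r le_rfl hr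
  · rw [Finset.mem_range] at hj
    rw [mul_assoc, ← pow_add, mul_left_comm]
    exact hC _ (truncCoeff_nonneg_of_lt (by omega) (by omega)) _ _ (by omega) (by omega)

theorem exists_decomposition {k r : ℕ} (hk : 2 ≤ k) (hkn : k ≤ n) (hr : r ≤ n)
    (h : ∀ m, 0 ≤ truncCoeff n k (n - r) m) :
    ∃ H : HilbertDecomposition n (syzygyPiece K n k), ∀ i, r ≤ (H.retract i).numVars := by
  obtain ⟨l, hl, hsum⟩ :=
    AddSubmonoid.exists_list_of_mem_closure (truncSeries_mem_closure hkn hr h)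
  choose t d h1 h2 h3 using fun i : Fin l.length => hl (l.get i) (l.get_mem i)
  have hser : truncSeries n k n = ∑ i, PowerSeries.X ^ t i * geom ^ d i := by
    rw [← hsum, ← Finset.sum_congr rfl fun i _ => h3 i]
    simp
  refine ⟨⟨l.length, fun i => GradedRetract.ofVars K (h2 i), fun i => k + t i, fun e => ?_⟩,
    fun i => by simpa [GradedRetract.numVars_ofVars] using h1 i⟩
  have := finiteDimensional_syzygyPiece (K := K) (n := n) hk e
  refine FiniteDimensional.nonempty_linearEquiv_of_finrank_eq ?_
  rw [Module.finrank_pi_fintype]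
  zify
  rw [finrank_syzygyPiece hk]
  simp only [GradedRetract.finrank_piece_int, GradedRetract.numVars_ofVars]
  split_ifs with he
  · symm
    refine Finset.sum_eq_zero fun i _ => ?_
    rw [if_pos (by omega), Nat.cast_zero]
  · have h4 := congrArg (PowerSeries.coeff (e - k).toNat) hser
    rw [truncSeries, PowerSeries.coeff_mk, map_sum] at h4
    rw [h4]
    refine Finset.sum_congr rfl fun i _ => ?_
    rw [coeff_X_pow_mul_geom_pow]
    split_ifs with h5 h6 h6
    · omega
    · rw [show (e - (k + t i)).toNat = (e - k).toNat - t i by omega]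
    · rfl
    · omega

theorem le_syzygyHdepth {k r : ℕ} (hk : 2 ≤ k) (hkn : k ≤ n) (hr : r ≤ n)
    (h : ∀ m, 0 ≤ truncCoeff n k (n - r) m) : (r : ℕ∞) ≤ syzygyHdepth K n k := by
  obtain ⟨H, hH⟩ := exists_decomposition (K := K) hk hkn hr h
  refine le_trans ?_ (le_iSup _ H)
  exact le_iInf fun i => by exact_mod_cast hH i

theorem syzygyHdepth_le {k r m : ℕ} (hk : 2 ≤ k) (hr : r ≤ n)
    (h : truncCoeff n k (n - r) m < 0) : syzygyHdepth K n k ≤ r := by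
  refine iSup_le fun H => ?_
  by_contra hlt
  refine h.not_ge (truncCoeff_nonneg_of_decomposition hk hr H (fun i => ?_) m)
  exact_mod_cast (not_le.1 hlt).le.trans (iInf_le _ i)

/-- The empty decomposition, of depth ⊤, is excluded because the degree k piece has dimension C(n,
k) > 0. -/
theorem syzygyHdepth_le_self {k : ℕ} (hk : 2 ≤ k) (hkn : k ≤ n) : syzygyHdepth K n k ≤ n := by
  refine iSup_le fun H => ?_
  rcases isEmpty_or_nonempty (Fin H.size) with he | ⟨⟨i⟩⟩
  · have h1 := finrank_syzygyPiece (K := K) (n := n) hk k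
    rw [H.finrank_eq, Finset.univ_eq_empty, Finset.sum_empty, if_neg (lt_irrefl _), sub_self,
      Int.toNat_zero, truncCoeff_zero_right] at h1
    have := Nat.choose_pos hkn
    omega
  · exact (iInf_le _ i).trans (by exact_mod_cast (H.retract i).numVars_le)

end

/-! ### The exponential rate and its least critical zero. -/

/-- The logarithm of `quotBase`, as a combination of values of `x ↦ -x log x`. -/
def logQuot (α β γ : ℝ) : ℝ :=
  Real.negMulLog α + Real.negMulLog β + Real.negMulLog γ + Real.negMulLog (1 - β) +
    Real.negMulLog (1 - γ) - Real.negMulLog (α + γ) - Real.negMulLog (α + β) -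
    Real.negMulLog (1 - α - β - γ)

theorem continuous_logQuot : Continuous fun p : ℝ × ℝ × ℝ => logQuot p.1 p.2.1 p.2.2 := by
  unfold logQuot
  have := Real.continuous_negMulLog
  fun_prop

theorem rpow_self_eq_exp {x : ℝ} (hx : 0 ≤ x) : x ^ x = Real.exp (-Real.negMulLog x) := by
  rcases hx.eq_or_lt with rfl | hx
  · simp
  · rw [Real.rpow_def_of_pos hx, Real.negMulLog]
    ring_nf

theorem quotBase_eq_exp {α β γ : ℝ} (hα : 0 ≤ α) (hβ : 0 ≤ β) (hγ : 0 ≤ γ)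
    (h : α + β + γ ≤ 1) : quotBase α β γ = Real.exp (logQuot α β γ) := by
  rw [quotBase, rpow_self_eq_exp hα, rpow_self_eq_exp hβ, rpow_self_eq_exp hγ,
    rpow_self_eq_exp (by linarith : 0 ≤ α + γ), rpow_self_eq_exp (by linarith : 0 ≤ α + β),
    rpow_self_eq_exp (by linarith : 0 ≤ 1 - α - β - γ), rpow_self_eq_exp (by linarith : 0 ≤ 1 - β),
    rpow_self_eq_exp (by linarith : 0 ≤ 1 - γ)]
  simp only [← Real.exp_add, ← Real.exp_sub]
  congr 1
  rw [logQuot]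
  ring

/-- The γ-derivative is log ((α + γ) / γ) + log ((1 - γ) / (1 - α - β - γ)); the second term is
positive because β > 0. -/
theorem logQuot_strictMonoOn {α β : ℝ} (hα : 0 ≤ α) (hβ : 0 < β) :
    StrictMonoOn (fun γ => logQuot α β γ) (Set.Icc 0 (1 - α - β)) := by
  refine strictMonoOn_of_hasDerivWithinAt_pos (convex_Icc _ _) (f' := fun γ =>
    (-Real.log γ - 1) + (-Real.log (1 - γ) - 1) * (-1) - (-Real.log (α + γ) - 1) * 1 -
      (-Real.log (1 - α - β - γ) - 1) * (-1)) ?_ ?_ ?_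
  · exact (continuous_logQuot.comp (by fun_prop : Continuous fun γ : ℝ => (α, β, γ))).continuousOn
  · intro γ hγ
    rw [interior_Icc] at hγ
    obtain ⟨h0, h1⟩ := hγ
    refine HasDerivAt.hasDerivWithinAt ?_
    have d1 := Real.hasDerivAt_negMulLog h0.ne'
    have d2 := (Real.hasDerivAt_negMulLog (by linarith : 1 - γ ≠ 0)).comp γ
      ((hasDerivAt_id γ).const_sub 1)
    have d3 := (Real.hasDerivAt_negMulLog (by linarith : α + γ ≠ 0)).comp γ
      ((hasDerivAt_id γ).const_add α)
    have d4 := (Real.hasDerivAt_negMulLog (by linarith : 1 - α - β - γ ≠ 0)).comp γ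
      ((hasDerivAt_id γ).const_sub (1 - α - β))
    exact (((((d1.const_add _).add_const _).add d2).sub d3).sub_const _).sub d4
  · intro γ hγ
    rw [interior_Icc] at hγ
    obtain ⟨h0, h1⟩ := hγ
    have l1 : Real.log γ ≤ Real.log (α + γ) := Real.log_le_log h0 (by linarith)
    have l2 : Real.log (1 - α - β - γ) < Real.log (1 - γ) :=
      Real.log_lt_log (by linarith) (by linarith)
    linarith

theorem hasDerivAt_logQuot_left {α β γ : ℝ} (hα : 0 < α) (hβ : 0 < β) (hγ : 0 ≤ γ)
    (h : α < 1 - β - γ) :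
    HasDerivAt (fun α => logQuot α β γ) (Real.log ((α + γ) * (α + β)) -
      Real.log (α * (1 - α - β - γ))) α := by
  have d1 := Real.hasDerivAt_negMulLog hα.ne'
  have d2 := (Real.hasDerivAt_negMulLog (by linarith : α + γ ≠ 0)).comp α
    ((hasDerivAt_id α).add_const γ)
  have d3 := (Real.hasDerivAt_negMulLog (by linarith : α + β ≠ 0)).comp α
    ((hasDerivAt_id α).add_const β)
  have d4 := (Real.hasDerivAt_negMulLog (by linarith : 1 - α - β - γ ≠ 0)).comp α
    ((((hasDerivAt_id α).const_sub 1).sub_const β).sub_const γ)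
  have d := ((((((((d1.add_const (Real.negMulLog β)).add_const (Real.negMulLog γ)).add_const
    (Real.negMulLog (1 - β))).add_const (Real.negMulLog (1 - γ))).sub d2).sub d3).sub d4))
  refine d.congr_deriv ?_
  rw [Real.log_mul (by linarith) (by linarith), Real.log_mul (by linarith) (by linarith)]
  ring

theorem continuous_logQuot_left (β γ : ℝ) : Continuous fun α => logQuot α β γ :=
  continuous_logQuot.comp (by fun_prop : Continuous fun α : ℝ => (α, β, γ))

/-- The quadratic is (α + γ)(α + β) - α(1 - α - β - γ), so its sign is that of the α-derivative of
`logQuot`. -/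
theorem logQuot_monotoneOn {β γ a b : ℝ} (hβ : 0 < β) (hγ : 0 ≤ γ) (ha : 0 ≤ a)
    (hb : b ≤ 1 - β - γ)
    (h : ∀ α, a < α → α < b → 0 ≤ 2 * α ^ 2 - (1 - 2 * β - 2 * γ) * α + β * γ) :
    MonotoneOn (fun α => logQuot α β γ) (Set.Icc a b) := by
  refine monotoneOn_of_hasDerivWithinAt_nonneg (convex_Icc _ _)
    (continuous_logQuot_left β γ).continuousOn (f' := fun α => Real.log ((α + γ) * (α + β)) -
      Real.log (α * (1 - α - β - γ))) ?_ ?_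
  · intro α hα
    rw [interior_Icc] at hα
    exact (hasDerivAt_logQuot_left (by linarith [hα.1]) hβ hγ
      (by linarith [hα.2])).hasDerivWithinAt
  · intro α hα
    rw [interior_Icc] at hα
    have := h α hα.1 hα.2
    refine sub_nonneg.2 (Real.log_le_log (mul_pos (by linarith [hα.1]) (by linarith [hα.2])) ?_)
    linarith

theorem logQuot_antitoneOn {β γ a b : ℝ} (hβ : 0 < β) (hγ : 0 ≤ γ) (ha : 0 ≤ a)
    (hb : b ≤ 1 - β - γ)
    (h : ∀ α, a < α → α < b → 2 * α ^ 2 - (1 - 2 * β - 2 * γ) * α + β * γ ≤ 0) :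
    AntitoneOn (fun α => logQuot α β γ) (Set.Icc a b) := by
  refine antitoneOn_of_hasDerivWithinAt_nonpos (convex_Icc _ _)
    (continuous_logQuot_left β γ).continuousOn (f' := fun α => Real.log ((α + γ) * (α + β)) -
      Real.log (α * (1 - α - β - γ))) ?_ ?_
  · intro α hα
    rw [interior_Icc] at hα
    exact (hasDerivAt_logQuot_left (by linarith [hα.1]) hβ hγ
      (by linarith [hα.2])).hasDerivWithinAt
  · intro α hα
    rw [interior_Icc] at hα
    have := h α hα.1 hα.2
    refine sub_nonpos.2 (Real.log_le_log (mul_pos (by linarith [hα.1]) (by linarith [hα.1])) ?_)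
    linarith

theorem logQuot_zero_zero (β : ℝ) : logQuot 0 β 0 = 0 := by
  simp [logQuot]

theorem logQuot_zero_nonneg {β γ : ℝ} (hβ : 0 < β) (hγ : 0 ≤ γ) (h : β + γ ≤ 1) :
    0 ≤ logQuot 0 β γ := by
  have := (logQuot_strictMonoOn le_rfl hβ).monotoneOn ⟨le_rfl, by linarith⟩ ⟨hγ, by linarith⟩ hγ
  exact (logQuot_zero_zero β).ge.trans this

theorem critPoint_bounds {β γ : ℝ} (hβ : 0 < β) (hγ : 0 ≤ γ) (hb : 0 ≤ 1 - 2 * β - 2 * γ) :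
    √(critDisc β γ) ≤ 1 - 2 * β - 2 * γ ∧ 0 ≤ critPoint β γ ∧
      critPoint β γ + β + γ ≤ 1 / 2 := by
  have h : √(critDisc β γ) ≤ 1 - 2 * β - 2 * γ := by
    refine Real.sqrt_le_iff.2 ⟨hb, ?_⟩
    rw [critDisc]
    have := mul_nonneg hβ.le hγ
    linarith
  have h0 := Real.sqrt_nonneg (critDisc β γ)
  refine ⟨h, ?_, ?_⟩ <;> rw [critPoint] <;> linarith

/-- If `logQuot` is nonnegative at the critical point, then it is so everywhere. -/
theorem logQuot_nonneg {α β γ : ℝ} (hβ : 0 < β) (hγ : 0 ≤ γ) (hb : 0 ≤ 1 - 2 * β - 2 * γ)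
    (hd : 0 ≤ critDisc β γ) (hcrit : 0 ≤ logQuot (critPoint β γ) β γ) (hα : 0 ≤ α)
    (h : α + β + γ ≤ 1) : 0 ≤ logQuot α β γ := by
  obtain ⟨hs, h1, h2⟩ := critPoint_bounds hβ hγ hb
  set s := √(critDisc β γ) with hs_def
  have hs0 : 0 ≤ s := Real.sqrt_nonneg _
  have hss : s ^ 2 = (1 - 2 * β - 2 * γ) ^ 2 - 8 * β * γ := Real.sq_sqrt hd
  have hα2 : critPoint β γ = (1 / 4) * (1 - 2 * β - 2 * γ + s) := rfl
  -- The rate rises up to the smaller root, falls up to `critPoint`, and rises again, so its minimum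
  -- is attained at α = 0 or at `critPoint`.
  have hfac (x : ℝ) : 2 * x ^ 2 - (1 - 2 * β - 2 * γ) * x + β * γ =
      2 * (x - (1 / 4) * (1 - 2 * β - 2 * γ - s)) * (x - critPoint β γ) := by
    rw [hα2]
    linear_combination (1 / 8) * hss
  rcases le_total α ((1 / 4) * (1 - 2 * β - 2 * γ - s)) with h3 | h3
  · have hm := logQuot_monotoneOn (a := 0) (b := (1 / 4) * (1 - 2 * β - 2 * γ - s)) hβ hγ le_rfl
      (by linarith) fun x _ hx => by
        rw [hfac]
        exact mul_nonneg_of_nonpos_of_nonpos (by linarith) (by linarith)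
    exact (logQuot_zero_nonneg hβ hγ (by linarith)).trans
      (hm ⟨le_rfl, hα.trans h3⟩ ⟨hα, h3⟩ hα)
  rcases le_total α (critPoint β γ) with h4 | h4
  · have hm := logQuot_antitoneOn (a := (1 / 4) * (1 - 2 * β - 2 * γ - s)) (b := critPoint β γ)
      hβ hγ (by linarith) (by linarith) fun x hx hx' => by
        rw [hfac]
        exact mul_nonpos_of_nonneg_of_nonpos (by linarith) (by linarith)
    exact hcrit.trans (hm ⟨h3, h4⟩ ⟨h3.trans h4, le_rfl⟩ h4)
  · have hm := logQuot_monotoneOn (a := critPoint β γ) (b := 1 - β - γ) hβ hγ h1 le_rfl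
      fun x hx _ => by
        rw [hfac]
        exact mul_nonneg (by linarith) (by linarith)
    exact hcrit.trans (hm ⟨le_rfl, by linarith⟩ ⟨h4, by linarith⟩ h4)

/-- The smallest solution of `quotBase (critPoint β γ) β γ = 1`. -/
theorem exists_least_solution {β : ℝ} (hβ : 0 < β) (hβ' : β ≤ 1 / 2) :
    ∃ γ : ℝ, IsLeast {g : ℝ | 0 ≤ g ∧ 0 ≤ critDisc β g ∧ quotBase (critPoint β g) β g = 1} γ ∧
      γ + β < 1 ∧ (∀ α, 0 ≤ α → α + β + γ ≤ 1 → 0 ≤ logQuot α β γ) ∧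
      ∃ α, 0 ≤ α ∧ α + β + γ ≤ 1 / 2 ∧ logQuot α β γ = 0 := by
  -- Since `critDisc β g` = (1 - 2g)² - (2q)², the discriminant vanishes first at g = 1/2 - q. The
  -- intermediate value theorem is applied on [0, 1/2 - q]; any admissible g beyond this interval
  -- exceeds the zero found in it.
  set q := √(β * (1 - β)) with hq
  have hqq : q ^ 2 = β * (1 - β) := Real.sq_sqrt (mul_nonneg hβ.le (by linarith))
  have hqβ : β ≤ q := Real.le_sqrt_of_sq_le (by nlinarith)
  have hq2 : q ≤ 1 / 2 := Real.sqrt_le_iff.2 ⟨by norm_num, by nlinarith [sq_nonneg (β - 1 / 2)]⟩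
  have hdisc (g : ℝ) : critDisc β g = (1 - 2 * g) ^ 2 - (2 * q) ^ 2 := by
    rw [critDisc]
    linear_combination 4 * hqq
  have hd {g : ℝ} (hg : g ≤ 1 / 2 - q) : 0 ≤ critDisc β g := by
    rw [hdisc, sub_nonneg]
    exact pow_le_pow_left₀ (by linarith) (by linarith) 2
  have hb {g : ℝ} (hg : g ≤ 1 / 2 - q) : 0 ≤ 1 - 2 * β - 2 * g := by linarith
  have hquot {g : ℝ} (hg0 : 0 ≤ g) (hg : g ≤ 1 / 2 - q) :
      quotBase (critPoint β g) β g = Real.exp (logQuot (critPoint β g) β g) := by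
    obtain ⟨-, h1, h2⟩ := critPoint_bounds hβ hg0 (hb hg)
    exact quotBase_eq_exp h1 hβ.le hg0 (by linarith)
  have hcont : Continuous fun g => logQuot (critPoint β g) β g := by
    refine continuous_logQuot.comp (f := fun g : ℝ => (critPoint β g, β, g)) ?_
    unfold critPoint critDisc
    fun_prop
  have hF0 : logQuot (critPoint β 0) β 0 ≤ 0 := by
    obtain ⟨-, h1, h2⟩ := critPoint_bounds hβ le_rfl (by linarith)
    have hm := logQuot_antitoneOn (a := 0) (b := critPoint β 0) hβ le_rfl le_rfl (by linarith)
      fun x hx hx' => by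
        have : x * (2 * x - (1 - 2 * β)) ≤ 0 :=
          mul_nonpos_of_nonneg_of_nonpos hx.le (by linarith)
        linarith
    exact (hm ⟨le_rfl, h1⟩ ⟨h1, le_rfl⟩ h1).trans (logQuot_zero_zero β).le
  -- At zero discriminant the quadratic is twice a square, so the rate is monotone from its
  -- nonnegative value at α = 0.
  have hF1 : 0 ≤ logQuot (critPoint β (1 / 2 - q)) β (1 / 2 - q) := by
    have hg0 : 0 ≤ 1 / 2 - q := by linarith
    obtain ⟨-, h1, h2⟩ := critPoint_bounds hβ hg0 (hb le_rfl)
    have hz := hdisc (1 / 2 - q)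
    rw [critDisc] at hz
    have hm := logQuot_monotoneOn (a := 0) (b := critPoint β (1 / 2 - q)) hβ hg0 le_rfl
      (by linarith) fun x _ _ => by
        have := sq_nonneg (x - (1 - 2 * β - 2 * (1 / 2 - q)) / 4)
        nlinarith
    exact (logQuot_zero_nonneg hβ hg0 (by linarith)).trans
      (hm ⟨le_rfl, h1⟩ ⟨h1, le_rfl⟩ h1)
  have hne : (Set.Icc 0 (1 / 2 - q) ∩ {g | logQuot (critPoint β g) β g = 0}).Nonempty := by
    obtain ⟨g, hg, hg'⟩ := intermediate_value_Icc (by linarith : (0 : ℝ) ≤ 1 / 2 - q)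
      hcont.continuousOn ⟨hF0, hF1⟩
    exact ⟨g, hg, hg'⟩
  obtain ⟨γ, ⟨⟨hγ0, hγ1⟩, hγ⟩, hleast⟩ :=
    (isCompact_Icc.inter_right (isClosed_eq hcont continuous_const)).exists_isLeast hne
  obtain ⟨-, h1, h2⟩ := critPoint_bounds hβ hγ0 (hb hγ1)
  refine ⟨γ, ⟨⟨hγ0, hd hγ1, ?_⟩, ?_⟩, by linarith, fun α hα h => ?_, _, h1, h2, hγ⟩
  · rw [hquot hγ0 hγ1, hγ, Real.exp_zero]
  · rintro g ⟨hg0, -, hg⟩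
    rcases le_total g (1 / 2 - q) with hg1 | hg1
    · refine hleast ⟨⟨hg0, hg1⟩, ?_⟩
      rw [hquot hg0 hg1] at hg
      exact Real.exp_eq_one_iff _ |>.1 hg
    · exact hγ1.trans hg1
  · exact logQuot_nonneg hβ hγ0 (hb hγ1) (hd hγ1) (le_of_eq hγ.symm) hα h

/-! ### Stirling bounds for the quotient of binomials. -/

/-- The error in the approximation of `log N!` by `N log N - N`. -/
def logFactorialError (N : ℕ) : ℝ := Real.log N.factorial + Real.negMulLog N + N

theorem logFactorialError_succ (N : ℕ) :
    logFactorialError (N + 1) =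
      logFactorialError N + 1 - N * (Real.log (N + 1) - Real.log N) := by
  have h : Real.log ((N + 1).factorial : ℝ) = Real.log (N + 1) + Real.log N.factorial := by
    rw [Nat.factorial_succ, Nat.cast_mul, Real.log_mul (by positivity) (by positivity)]
    push_cast
    rfl
  rw [logFactorialError, logFactorialError, h, Real.negMulLog, Real.negMulLog]
  push_cast
  ring

theorem mul_log_succ_sub_log_le (N : ℕ) : (N : ℝ) * (Real.log (N + 1) - Real.log N) ≤ 1 := by
  rcases N.eq_zero_or_pos with rfl | hN
  · simp
  have hN' : (0 : ℝ) < N := by exact_mod_cast hN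
  rw [← Real.log_div (by positivity) (by positivity)]
  have h := Real.log_le_sub_one_of_pos (by positivity : 0 < ((N : ℝ) + 1) / N)
  calc (N : ℝ) * Real.log ((N + 1) / N) ≤ N * ((N + 1) / N - 1) := by gcongr
    _ = 1 := by field_simp; ring

theorem le_succ_mul_log_succ_sub_log {N : ℕ} (hN : 0 < N) :
    1 ≤ ((N : ℝ) + 1) * (Real.log (N + 1) - Real.log N) := by
  have hN' : (0 : ℝ) < N := by exact_mod_cast hN
  have h := Real.log_le_sub_one_of_pos (by positivity : 0 < (N : ℝ) / (N + 1))
  rw [Real.log_div (by positivity) (by positivity)] at h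
  have : ((N : ℝ) + 1) * (Real.log N - Real.log (N + 1)) ≤ ((N : ℝ) + 1) * (N / (N + 1) - 1) := by
    gcongr
  have e : ((N : ℝ) + 1) * (N / (N + 1) - 1) = -1 := by field_simp; ring
  linarith

theorem logFactorialError_nonneg (N : ℕ) : 0 ≤ logFactorialError N := by
  induction N with
  | zero => simp [logFactorialError]
  | succ N ih =>
    rw [logFactorialError_succ]
    linarith [mul_log_succ_sub_log_le N]

/-- For N ≥ 1 the increment 1 - N Δ, with Δ = log (N + 1) - log N, is at most Δ, so the bounds
telescope. -/
theorem logFactorialError_le (N : ℕ) : logFactorialError N ≤ Real.log N + 1 := by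
  induction N with
  | zero => simp [logFactorialError]
  | succ N ih =>
    rw [logFactorialError_succ]
    rcases N.eq_zero_or_pos with rfl | hN
    · simp [logFactorialError]
    · have := le_succ_mul_log_succ_sub_log hN
      push_cast
      linarith

theorem logFactorialError_le_of_le {N n : ℕ} (h : N ≤ n) :
    logFactorialError N ≤ Real.log n + 1 := by
  refine (logFactorialError_le N).trans ?_
  rcases N.eq_zero_or_pos with rfl | hN
  · simpa using Real.log_natCast_nonneg n
  · have : Real.log N ≤ Real.log n := Real.log_le_log (by exact_mod_cast hN) (by exact_mod_cast h)
    linarith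

theorem log_add_choose (a b : ℕ) : Real.log ((a + b).choose a) =
    Real.log (a + b).factorial - Real.log a.factorial - Real.log b.factorial := by
  have h := congrArg (fun x : ℕ => Real.log x) (Nat.add_choose_mul_factorial_mul_factorial a b)
  rw [Nat.choose_symm_add]
  have hc : ((a + b).choose b : ℝ) ≠ 0 := by exact_mod_cast (Nat.choose_pos (by omega)).ne'
  simp only [Nat.cast_mul] at h
  rw [Real.log_mul (by positivity) (by positivity), Real.log_mul hc (by positivity)] at h
  linarith

theorem log_factorial_eq (N : ℕ) :
    Real.log N.factorial = logFactorialError N - Real.negMulLog N - N := by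
  rw [logFactorialError]
  ring

/-- The logarithm of the quotient of binomials compared with its leading term. -/
theorem log_choose_quotient {n k M g q : ℕ} (hn : n = k + M + g + q) (hpos : 0 < n) :
    Real.log (n.choose k) + Real.log ((g + M).choose M) - Real.log ((n - g).choose (k + M)) =
      n * logQuot (M / n) (k / n) (g / n) +
      (logFactorialError n + logFactorialError (g + M) + logFactorialError (k + M) +
        logFactorialError q - logFactorialError k - logFactorialError (M + g + q) -
        logFactorialError g - logFactorialError M - logFactorialError (k + M + q)) := by
  have hn0 : (n : ℝ) ≠ 0 := by exact_mod_cast hpos.ne'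
  -- After rescaling by n, the multiples of `negMulLog n` add up to exactly one, which is the share
  -- of n!.
  have hscale (x : ℝ) :
      (n : ℝ) * Real.negMulLog (x / n) = Real.negMulLog x - x / n * Real.negMulLog n := by
    have := Real.negMulLog_mul n (x / n)
    rw [mul_div_cancel₀ x hn0] at this
    linarith
  have e1 : Real.log (n.choose k) = Real.log n.factorial - Real.log k.factorial -
      Real.log (M + g + q).factorial := by
    have := log_add_choose k (M + g + q)
    rwa [show k + (M + g + q) = n by omega] at this
  have e2 : Real.log ((g + M).choose M) = Real.log (g + M).factorial - Real.log M.factorial -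
      Real.log g.factorial := by
    have := log_add_choose M g
    rwa [add_comm M g] at this
  have e3 : Real.log ((n - g).choose (k + M)) = Real.log (k + M + q).factorial -
      Real.log (k + M).factorial - Real.log q.factorial := by
    have := log_add_choose (k + M) q
    rwa [show k + M + q = n - g by omega] at this ⊢
  have hnr : (n : ℝ) = k + M + g + q := by exact_mod_cast hn
  have a1 : 1 - (k : ℝ) / n = (M + g + q) / n := by field_simp; linarith
  have a2 : 1 - (g : ℝ) / n = (k + M + q) / n := by field_simp; linarith
  have a3 : 1 - (M : ℝ) / n - k / n - g / n = q / n := by field_simp; linarith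
  rw [e1, e2, e3, logQuot, a1, a2, a3, ← add_div, ← add_div]
  simp only [mul_add, mul_sub, hscale, log_factorial_eq]
  push_cast
  have hsum : ((k : ℝ) + M + g + q) / n = 1 := by rw [← hnr]; exact div_self hn0
  rw [add_comm (g : ℝ) M, add_comm (k : ℝ) M]
  linear_combination Real.negMulLog (n : ℝ) * hsum - hnr

theorem log_choose_quotient_bounds {n k M g : ℕ} (hn : k + M + g ≤ n) (hpos : 0 < n) :
    n * logQuot (M / n) (k / n) (g / n) - 5 * (Real.log n + 1) ≤
      Real.log (n.choose k) + Real.log ((g + M).choose M) - Real.log ((n - g).choose (k + M)) ∧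
    Real.log (n.choose k) + Real.log ((g + M).choose M) - Real.log ((n - g).choose (k + M)) ≤
      n * logQuot (M / n) (k / n) (g / n) + 4 * (Real.log n + 1) := by
  obtain ⟨q, hq⟩ : ∃ q, n = k + M + g + q := ⟨n - (k + M + g), by omega⟩
  rw [log_choose_quotient hq hpos]
  have l (N : ℕ) := logFactorialError_nonneg N
  have u {N : ℕ} (h : N ≤ n) := logFactorialError_le_of_le h
  constructor
  · linarith [l n, l (g + M), l (k + M), l q, u (by omega : k ≤ n), u (by omega : M + g + q ≤ n),
      u (by omega : g ≤ n), u (by omega : M ≤ n), u (by omega : k + M + q ≤ n)]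
  · linarith [u le_rfl, u (by omega : g + M ≤ n), u (by omega : k + M ≤ n), u (by omega : q ≤ n),
      l k, l (M + g + q), l g, l M, l (k + M + q)]

/-- The constant 7 is 5 for the Stirling errors plus 2 for a factor n². That factor pays for n - g +
1 ≤ n and for g + m + 1 ≤ n, the latter arising from C(g + m + 1, m + 1) g = C(g + m, m + 1) (g + m
+ 1). -/
theorem mul_choose_le_of_logQuot {n k m g : ℕ} (hk : 1 ≤ k) (hg : 1 ≤ g)
    (hn : k + m + 1 + g ≤ n)
    (h : 7 * (Real.log n + 1) ≤ n * logQuot ((m + 1 : ℕ) / n) (k / n) (g / n)) :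
    (n - g + 1) * (n - g).choose (k + m + 1) ≤ k * n.choose k * (g + m).choose (m + 1) := by
  have hn0 : (0 : ℝ) < n := by exact_mod_cast (by omega : 0 < n)
  have hb := (log_choose_quotient_bounds (M := m + 1) (by omega : k + (m + 1) + g ≤ n)
    (by omega)).1
  have p1 : 0 < n.choose k := Nat.choose_pos (by omega)
  have p2 : 0 < (g + (m + 1)).choose (m + 1) := Nat.choose_pos (by omega)
  have p3 : 0 < (n - g).choose (k + (m + 1)) := Nat.choose_pos (by omega)
  have hlog : Real.log ((n : ℝ) * n * (n - g).choose (k + (m + 1))) ≤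
      Real.log (n.choose k * (g + (m + 1)).choose (m + 1)) := by
    rw [Real.log_mul (by positivity) (by positivity), Real.log_mul (by positivity) (by positivity),
      Real.log_mul (by positivity) (by positivity)]
    linarith
  have hle := (Real.log_le_log_iff (by positivity) (by positivity)).1 hlog
  have hle' : n * n * (n - g).choose (k + (m + 1)) ≤
      n.choose k * (g + (m + 1)).choose (m + 1) := by exact_mod_cast hle
  have hsucc := Nat.choose_mul_succ_eq (g + m) (m + 1)
  rw [show g + m + 1 - (m + 1) = g by omega] at hsucc
  refine Nat.le_of_mul_le_mul_right (c := g + m + 1) ?_ (by omega)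
  calc (n - g + 1) * (n - g).choose (k + m + 1) * (g + m + 1)
      ≤ n * (n - g).choose (k + m + 1) * n := by gcongr <;> omega
    _ = n * n * (n - g).choose (k + (m + 1)) := by rw [← add_assoc]; ring
    _ ≤ n.choose k * (g + (m + 1)).choose (m + 1) := hle'
    _ ≤ (k * g) * (n.choose k * (g + (m + 1)).choose (m + 1)) :=
        Nat.le_mul_of_pos_left _ (by positivity)
    _ = k * n.choose k * ((g + m + 1).choose (m + 1) * g) := by rw [← add_assoc]; ring
    _ = k * n.choose k * (g + m).choose (m + 1) * (g + m + 1) := by rw [← hsucc]; ring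

theorem mul_choose_lt_of_logQuot {n k m g : ℕ} (hk : 1 ≤ k) (hn : k + m + 1 + g ≤ n)
    (h : n * logQuot ((m + 1 : ℕ) / n) (k / n) (g / n) + 4 * (Real.log n + 1) < 0) :
    k * n.choose k * (g + m).choose (m + 1) < (k + m + 1) * (n - g).choose (k + m + 1) := by
  have hb := (log_choose_quotient_bounds (M := m + 1) (by omega : k + (m + 1) + g ≤ n)
    (by omega)).2
  have p1 : 0 < n.choose k := Nat.choose_pos (by omega)
  have p2 : 0 < (g + (m + 1)).choose (m + 1) := Nat.choose_pos (by omega)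
  have p3 : 0 < (n - g).choose (k + (m + 1)) := Nat.choose_pos (by omega)
  have hlog : Real.log (n.choose k * (g + (m + 1)).choose (m + 1)) <
      Real.log ((n - g).choose (k + (m + 1))) := by
    rw [Real.log_mul (by positivity) (by positivity)]
    linarith
  have hlt := (Real.log_lt_log_iff (by positivity) (by positivity)).1 hlog
  have hlt' : n.choose k * (g + (m + 1)).choose (m + 1) < (n - g).choose (k + (m + 1)) := by
    exact_mod_cast hlt
  calc k * n.choose k * (g + m).choose (m + 1)
      ≤ k * n.choose k * (g + (m + 1)).choose (m + 1) := by
        gcongr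
        omega
    _ = k * (n.choose k * (g + (m + 1)).choose (m + 1)) := mul_assoc _ _ _
    _ < k * (n - g).choose (k + (m + 1)) := by gcongr
    _ ≤ (k + m + 1) * (n - g).choose (k + m + 1) := by
        rw [← add_assoc]
        gcongr
        omega

/-! ### Asymptotic bounds for the Hilbert depth. -/

open Topology

theorem eventually_mul_log_le {δ : ℝ} (hδ : 0 < δ) (c : ℝ) :
    ∀ᶠ n : ℕ in atTop, c * (Real.log n + 1) ≤ n * δ := by
  have h1 : Tendsto (fun n : ℕ => c * (Real.log n / n + 1 / n)) atTop (𝓝 (c * (0 + 0))) := by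
    refine Tendsto.const_mul c (Tendsto.add ?_ tendsto_one_div_atTop_nhds_zero_nat)
    exact (Real.isLittleO_log_id_atTop.tendsto_div_nhds_zero).comp tendsto_natCast_atTop_atTop
  rw [add_zero, mul_zero] at h1
  filter_upwards [h1.eventually_lt_const hδ, eventually_gt_atTop 0] with n h hn
  have hn' : (0 : ℝ) < n := by exact_mod_cast hn
  rw [← add_div, ← mul_div_assoc, div_lt_iff₀ hn'] at h
  linarith

/-- Writing α = t(1 - β - γ) makes the range of the parameter the fixed compact interval [0, 1], so
one δ serves all t and all nearby (β, γ). -/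
theorem exists_eventually_logQuot_ge {β γ₀ γ : ℝ} (hβ : 0 < β) (hγ₀ : 0 ≤ γ₀) (hγ : γ₀ < γ)
    (h1 : γ + β < 1) (h0 : ∀ α, 0 ≤ α → α + β + γ₀ ≤ 1 → 0 ≤ logQuot α β γ₀) :
    ∃ δ > 0, ∀ᶠ p : ℝ × ℝ in 𝓝 (β, γ), ∀ t ∈ Set.Icc (0 : ℝ) 1,
      δ < logQuot (t * (1 - p.1 - p.2)) p.1 p.2 := by
  have hcont : Continuous fun x : (ℝ × ℝ) × ℝ =>
      logQuot (x.2 * (1 - x.1.1 - x.1.2)) x.1.1 x.1.2 :=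
    continuous_logQuot.comp (f := fun x : (ℝ × ℝ) × ℝ =>
      (x.2 * (1 - x.1.1 - x.1.2), x.1.1, x.1.2)) (by fun_prop)
  have hpos (t : ℝ) (ht : t ∈ Set.Icc (0 : ℝ) 1) : 0 < logQuot (t * (1 - β - γ)) β γ := by
    have ha : 0 ≤ t * (1 - β - γ) := mul_nonneg ht.1 (by linarith)
    have ha' : t * (1 - β - γ) ≤ 1 - β - γ := mul_le_of_le_one_left (by linarith) ht.2
    exact (h0 _ ha (by linarith)).trans_lt
      (logQuot_strictMonoOn ha hβ ⟨hγ₀, by linarith⟩ ⟨by linarith, by linarith⟩ hγ)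
  obtain ⟨t₀, ht₀, hmin⟩ := (isCompact_Icc (a := (0 : ℝ)) (b := 1)).exists_isMinOn
    (Set.nonempty_Icc.2 zero_le_one)
    (hcont.comp (by fun_prop : Continuous fun t : ℝ => ((β, γ), t))).continuousOn
  have hδ := hpos t₀ ht₀
  refine ⟨_, half_pos hδ, isCompact_Icc.eventually_forall_of_forall_eventually fun t ht => ?_⟩
  refine hcont.continuousAt.eventually_const_lt (lt_of_lt_of_le (half_lt_self hδ) ?_)
  exact hmin ht

theorem tendsto_div_of_isLittleO {β : ℝ} {k : ℕ → ℕ}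
    (hk : (fun n : ℕ => (k n : ℝ) - β * n) =o[atTop] fun n : ℕ => (n : ℝ)) :
    Tendsto (fun n => (k n : ℝ) / n) atTop (𝓝 β) := by
  have h := hk.tendsto_div_nhds_zero.add_const β
  rw [zero_add] at h
  refine h.congr' ?_
  filter_upwards [eventually_gt_atTop 0] with n hn
  have hn' : (n : ℝ) ≠ 0 := by exact_mod_cast hn.ne'
  field_simp
  ring

theorem eventually_le_of_tendsto_div {β : ℝ} {k : ℕ → ℕ} (hβ : 0 < β)
    (hk : Tendsto (fun n => (k n : ℝ) / n) atTop (𝓝 β)) (c : ℕ) :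
    ∀ᶠ n in atTop, c ≤ k n := by
  have h : Tendsto (fun n => (k n : ℝ)) atTop atTop := by
    refine (hk.pos_mul_atTop hβ tendsto_natCast_atTop_atTop).congr' ?_
    filter_upwards [eventually_gt_atTop 0] with n hn
    have hn' : (n : ℝ) ≠ 0 := by exact_mod_cast hn.ne'
    field_simp
  exact (tendsto_natCast_atTop_iff.1 h).eventually_ge_atTop c

theorem eventually_add_le {x y : ℕ → ℕ} {a b : ℝ}
    (hx : Tendsto (fun n => (x n : ℝ) / n) atTop (𝓝 a))
    (hy : Tendsto (fun n => (y n : ℝ) / n) atTop (𝓝 b)) (h : a + b < 1) :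
    ∀ᶠ n in atTop, x n + y n ≤ n := by
  filter_upwards [(hx.add hy).eventually_lt_const h, eventually_gt_atTop 0] with n h hn
  have hn' : (0 : ℝ) < n := by exact_mod_cast hn
  rw [← add_div, div_lt_iff₀ hn', one_mul] at h
  exact_mod_cast h.le

theorem eventually_le_syzygyHdepth (K : Type*) [Field K] {k : ℕ → ℕ} {β γ₀ γ : ℝ} (hβ : 0 < β)
    (hk : Tendsto (fun n => (k n : ℝ) / n) atTop (𝓝 β))
    (hγ₀ : 0 ≤ γ₀) (hγ : γ₀ < γ) (h1 : γ + β < 1)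
    (h0 : ∀ α, 0 ≤ α → α + β + γ₀ ≤ 1 → 0 ≤ logQuot α β γ₀) :
    ∀ᶠ n : ℕ in atTop, ((n - ⌈γ * n⌉₊ : ℕ) : ℕ∞) ≤ syzygyHdepth K n (k n) := by
  have hγpos : 0 < γ := hγ₀.trans_lt hγ
  have hg : Tendsto (fun n : ℕ => (⌈γ * n⌉₊ : ℝ) / n) atTop (𝓝 γ) :=
    (tendsto_nat_ceil_mul_div_atTop hγpos.le).comp tendsto_natCast_atTop_atTop
  obtain ⟨δ, hδ, hev⟩ := exists_eventually_logQuot_ge hβ hγ₀ hγ h1 h0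
  filter_upwards [(hk.prodMk_nhds hg).eventually hev, eventually_mul_log_le hδ 7,
    eventually_le_of_tendsto_div hβ hk 2, eventually_le_of_tendsto_div hγpos hg 1,
    eventually_add_le hg hk h1, eventually_gt_atTop 0] with n hn hlog hk2 hg1 hadd hn0
  have hn0' : (0 : ℝ) < n := by exact_mod_cast hn0
  refine le_syzygyHdepth hk2 (by omega) (Nat.sub_le _ _) fun m => ?_
  rw [Nat.sub_sub_self (by omega)]
  refine truncCoeff_nonneg hg1 (by omega) (fun m hm => ?_) m
  refine mul_choose_le_of_logQuot (by omega) hg1 hm (hlog.trans ?_)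
  generalize ⌈γ * n⌉₊ = g at *
  have hm' : (k n : ℝ) + (m + 1 : ℕ) + g ≤ n := by exact_mod_cast hm
  have hmpos : (0 : ℝ) < (m + 1 : ℕ) := by positivity
  have hle : ((m + 1 : ℕ) : ℝ) / n ≤ 1 - k n / n - g / n := by
    field_simp
    linarith
  have hpos : (0 : ℝ) < 1 - k n / n - g / n := (div_pos hmpos hn0').trans_le hle
  have := hn (((m + 1 : ℕ) : ℝ) / n / (1 - k n / n - g / n))
    ⟨by positivity, (div_le_one hpos).2 hle⟩
  rw [div_mul_cancel₀ _ hpos.ne'] at this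
  exact mul_le_mul_of_nonneg_left this.le hn0'.le

theorem eventually_syzygyHdepth_le (K : Type*) [Field K] {k : ℕ → ℕ} {β γ₀ γ α : ℝ} (hβ : 0 < β)
    (hk : Tendsto (fun n => (k n : ℝ) / n) atTop (𝓝 β))
    (hγ : 0 < γ) (hγ₀ : γ < γ₀) (hα : 0 ≤ α) (h1 : α + β + γ₀ ≤ 1)
    (h0 : logQuot α β γ₀ = 0) :
    ∀ᶠ n : ℕ in atTop, syzygyHdepth K n (k n) ≤ (n - ⌊γ * n⌋₊ : ℕ) := by
  have hg : Tendsto (fun n : ℕ => (⌊γ * n⌋₊ : ℝ) / n) atTop (𝓝 γ) :=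
    (tendsto_nat_floor_mul_div_atTop hγ.le).comp tendsto_natCast_atTop_atTop
  -- An odd index of size αn + O(1): only odd indices can carry a negative coefficient.
  have hm : Tendsto (fun n : ℕ => ((2 * ⌊α / 2 * n⌋₊ + 1 : ℕ) : ℝ) / n) atTop (𝓝 α) := by
    have h := (((tendsto_nat_floor_mul_div_atTop (by positivity : 0 ≤ α / 2)).comp
      tendsto_natCast_atTop_atTop).const_mul 2).add (tendsto_one_div_atTop_nhds_zero_nat (𝕜 := ℝ))
    rw [mul_div_cancel₀ α two_ne_zero, add_zero] at h
    refine h.congr fun n => ?_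
    simp only [Function.comp_apply]
    push_cast
    ring
  have hneg : logQuot α β γ < 0 := by
    rw [← h0]
    exact logQuot_strictMonoOn hα hβ ⟨hγ.le, by linarith⟩ ⟨by linarith, by linarith⟩ hγ₀
  have hlim := (continuous_logQuot.tendsto (α, β, γ)).comp
    (hm.prodMk_nhds (hk.prodMk_nhds hg))
  have hsum : ∀ᶠ n : ℕ in atTop, k n + (2 * ⌊α / 2 * n⌋₊ + 1) + ⌊γ * n⌋₊ ≤ n := by
    refine eventually_add_le (a := β + α) ?_ hg (by linarith)
    refine (hk.add hm).congr fun n => ?_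
    push_cast
    ring
  filter_upwards [hlim.eventually_lt_const (by linarith : logQuot α β γ < logQuot α β γ / 2),
    eventually_mul_log_le (by linarith : 0 < -(logQuot α β γ / 2)) 4,
    eventually_le_of_tendsto_div hβ hk 2, hsum, eventually_gt_atTop 0] with n hn hlog hk2 hle hn0
  have hn0' : (0 : ℝ) < n := by exact_mod_cast hn0
  refine syzygyHdepth_le (m := 2 * ⌊α / 2 * n⌋₊ + 1) hk2 (Nat.sub_le _ _) ?_
  rw [Nat.sub_sub_self (by omega)]
  refine truncCoeff_neg (even_two_mul _) (by omega) (mul_choose_lt_of_logQuot (by omega)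
    (by omega) ?_)
  have := mul_lt_mul_of_pos_left hn hn0'
  simp only [Function.comp_apply] at this
  linarith

end HilbertDepth

end

/-! ### Conclusion. -/

open HilbertDepth in
theorem theorem4p4 (K : Type*) [Field K] (β : ℝ) (hβ_pos : 0 < β) (hβ_le : β ≤ 1 / 2)
    (k : ℕ → ℕ) (hk : (fun n : ℕ => (k n : ℝ) - β * n) =o[atTop] fun n : ℕ => (n : ℝ)) :
    ∃ γ : ℝ,
      IsLeast {g : ℝ | 0 ≤ g ∧ 0 ≤ HilbertDepth.critDisc β g ∧
        HilbertDepth.quotBase (HilbertDepth.critPoint β g) β g = 1} γ ∧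
      (∀ᶠ n : ℕ in atTop, HilbertDepth.syzygyHdepth K n (k n) ≠ ⊤) ∧
      (fun n : ℕ => ((HilbertDepth.syzygyHdepth K n (k n)).toNat : ℝ) - (1 - γ) * n)
        =o[atTop] fun n : ℕ => (n : ℝ) := by
  obtain ⟨γ₀, hleast, hγβ, hnonneg, α, hα, hαβ, hzero⟩ := exists_least_solution hβ_pos hβ_le
  have hγ₀ : 0 ≤ γ₀ := hleast.1.1
  have hk' := tendsto_div_of_isLittleO hk
  have hself : ∀ᶠ n : ℕ in atTop, syzygyHdepth K n (k n) ≤ n := by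
    filter_upwards [eventually_le_of_tendsto_div hβ_pos hk' 2,
      eventually_add_le (y := fun _ => 0) hk' (by simp) (by linarith : β + 0 < 1)] with n h2 hn
    exact syzygyHdepth_le_self h2 hn
  refine ⟨γ₀, hleast, ?_, ?_⟩
  · filter_upwards [hself] with n hn
    exact ne_top_of_le_ne_top (ENat.natCast_ne_top n) hn
  refine isLittleO_iff.2 fun c hc => ?_
  have hlow : ∀ᶠ n : ℕ in atTop, -(c * n) ≤
      ((syzygyHdepth K n (k n)).toNat : ℝ) - (1 - γ₀) * n := by
    obtain ⟨γ, hγ, hγc, hγ1⟩ : ∃ γ, γ₀ < γ ∧ γ ≤ γ₀ + c / 2 ∧ γ + β < 1 := by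
      -- Half of the tolerance c moves γ off γ₀; the other half absorbs the rounding error, as 1 ≤
      -- (c / 2) n once n ≥ 2 / c. The minimum keeps γ + β < 1.
      refine ⟨γ₀ + min (c / 2) ((1 - β - γ₀) / 2), ?_, ?_, ?_⟩
      · have : 0 < min (c / 2) ((1 - β - γ₀) / 2) := lt_min (by linarith) (by linarith)
        linarith
      · linarith [min_le_left (c / 2) ((1 - β - γ₀) / 2)]
      · linarith [min_le_right (c / 2) ((1 - β - γ₀) / 2)]
    filter_upwards [eventually_le_syzygyHdepth K hβ_pos hk' hγ₀ hγ hγ1 hnonneg, hself,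
      tendsto_natCast_atTop_atTop.eventually_ge_atTop (2 / c)] with n h1 h2 hn
    have hfin := ne_top_of_le_ne_top (ENat.natCast_ne_top n) h2
    have h3 := ENat.toNat_le_toNat h1 hfin
    rw [ENat.toNat_natCast] at h3
    have h4 : (n : ℝ) ≤ (syzygyHdepth K n (k n)).toNat + ⌈γ * n⌉₊ := by
      exact_mod_cast tsub_le_iff_right.1 h3
    have h5 := Nat.ceil_lt_add_one (mul_nonneg (hγ₀.trans hγ.le) n.cast_nonneg : 0 ≤ γ * n)
    have h6 := mul_le_mul_of_nonneg_right hγc n.cast_nonneg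
    rw [div_le_iff₀ hc] at hn
    linarith
  have hup : ∀ᶠ n : ℕ in atTop,
      ((syzygyHdepth K n (k n)).toNat : ℝ) - (1 - γ₀) * n ≤ c * n := by
    -- If no positive γ = γ₀ - c / 2 is available, then γ₀ ≤ c and the trivial bound by n suffices.
    rcases le_or_gt (γ₀ - c / 2) 0 with hc0 | hc0
    · filter_upwards [hself] with n h2
      have h3 := ENat.toNat_le_toNat h2 (ENat.natCast_ne_top n)
      rw [ENat.toNat_natCast] at h3
      have h4 : ((syzygyHdepth K n (k n)).toNat : ℝ) ≤ n := by exact_mod_cast h3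
      have h5 := mul_le_mul_of_nonneg_right (by linarith : γ₀ ≤ c) n.cast_nonneg
      linarith
    · filter_upwards [eventually_syzygyHdepth_le K hβ_pos hk' hc0 (by linarith) hα
        (by linarith) hzero, tendsto_natCast_atTop_atTop.eventually_ge_atTop (2 / c)] with n h1 hn
      have h3 := ENat.toNat_le_toNat h1 (ENat.natCast_ne_top _)
      rw [ENat.toNat_natCast] at h3
      have h5 := Nat.lt_floor_add_one ((γ₀ - c / 2) * (n : ℝ))
      have hle : ⌊(γ₀ - c / 2) * (n : ℝ)⌋₊ ≤ n := by
        refine Nat.floor_le_of_le (mul_le_of_le_one_left n.cast_nonneg (by linarith))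
      have h4 : ((syzygyHdepth K n (k n)).toNat : ℝ) ≤ n - ⌊(γ₀ - c / 2) * (n : ℝ)⌋₊ := by
        rw [← Nat.cast_sub hle]
        exact_mod_cast h3
      rw [div_le_iff₀ hc] at hn
      linarith
  filter_upwards [hlow, hup] with n h1 h2
  rw [Real.norm_eq_abs, Real.norm_natCast, abs_le]
  exact ⟨h1, h2⟩
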